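/- Let $n\ge 2$, let $\mathbb{E}^n$ be Euclidean $n$-space with standard coordinates $(x^i)$ and flat metric $h=(\delta_{ij})$, and let $W=W^i\,\partial/\partial x^i$ be a smooth vector field on $\mathbb{E}^n$ of unit length, $\sum_i (W^i)^2=1$. Let $F=\alpha^2/\beta$ be the Kropina metric induced by the navigation data $(h,W)$: for a smooth function $k$ on $\mathbb{E}^n$ put $a_{ij}=e^{-k}\delta_{ij}$, $b_i=2e^{-k}W_i$ (with $W_i=\delta_{ij}W^j$), $\alpha^2=a_{ij}(x)y^iy^j$ and $\beta=b_i(x)y^i$, so that $F(x,y)=\dfrac{|y|^2}{2\langle W(x),y\rangle}$ does not depend on $k$; $F$ is a conic Finsler metric on the conic domain $A=\{(x,y)\in T\mathbb{E}^n : \beta(x,y)>0\}$. The space $(\mathbb{E}^n,F)$ is of constant flag curvature $K$ if $$\frac{R_{hijk}\,y^hX^iy^jX^k}{(g_{hj}g_{ik}-g_{hk}g_{ij})\,y^hX^iy^jX^k}=K$$ for all $(x,y)\in A$ and all $X\in T_x\mathbb{E}^n$ linearly independent of $y$. Here $g_{ij}=\tfrac12\,\partial^2F^2/\partial y^i\partial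 y^j$; $\gamma^i_{jk}=\tfrac12 g^{is}\bigl(\partial g_{sj}/\partial x^k-\partial g_{jk}/\partial x^s+\partial g_{ks}/\partial x^j\bigr)$; $G^i=\tfrac12\gamma^i_{jk}y^jy^k$; $N^i_j=\partial G^i/\partial y^j$; $\Gamma^i_{jk}=\partial N^i_j/\partial y^k$; $\delta/\delta x^l=\partial/\partial x^l-N^m_l\,\partial/\partial y^m$; $R_{j}{}^{i}{}_{kl}=\delta\Gamma^i_{jk}/\delta x^l+\Gamma^r_{jk}\Gamma^i_{rl}-(k\leftrightarrow l)$; and $R_{hijk}=g_{ir}R_{h}{}^{r}{}_{jk}$. Then $(\mathbb{E}^n,F)$ is of constant flag curvature $K=0$ if and only if $W$ has the form $W^i(x)=C^i$ for all $x\in\mathbb{E}^n$, where $(C^i)$ is a constant vector of unit length. -/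

import Mathlib

open scoped ContDiff

noncomputable section

namespace ConicFinsler

/-- `𝔼ⁿ` with its standard coordinates. Every tangent space is identified with `𝔼ⁿ` through the
frame `∂/∂x¹, …, ∂/∂xⁿ`, so that `T𝔼ⁿ = 𝔼ⁿ × 𝔼ⁿ` with coordinates `(x, y)`. -/
abbrev E (n : ℕ) : Type := EuclideanSpace ℝ (Fin n)

variable {n : ℕ}

/-- The partial derivative `∂f/∂xⁱ` of a function `f (x, y)` on (an open part of) `T𝔼ⁿ`. -/
def dx (i : Fin n) (f : E n → E n → ℝ) (x y : E n) : ℝ :=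
  fderiv ℝ (fun x' => f x' y) x (EuclideanSpace.single i 1)

/-- The partial derivative `∂f/∂yⁱ` of a function `f (x, y)` on (an open part of) `T𝔼ⁿ`. -/
def dy (i : Fin n) (f : E n → E n → ℝ) (x y : E n) : ℝ :=
  fderiv ℝ (fun y' => f x y') y (EuclideanSpace.single i 1)

/-! ### Geometric objects of a function `F (x, y)`

All of them are formed from derivatives of `F` at `(x, y)`; when `F` is a metric given on an open
set `A`, only their values at points of `A` are meaningful. -/

/-- The fundamental tensor `g_{ij} = ½ ∂²F² / ∂yⁱ∂yʲ`. -/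
def fundamentalTensor (F : E n → E n → ℝ) (x y : E n) : Matrix (Fin n) (Fin n) ℝ :=
  Matrix.of fun i j => dy i (dy j (fun x y => F x y ^ 2 / 2)) x y

/-- The Christoffel symbols of the second kind
`γⁱ_{jk} = ½ g^{is} (∂g_{sj}/∂xᵏ - ∂g_{jk}/∂xˢ + ∂g_{ks}/∂xʲ)`. -/
def christoffel (F : E n → E n → ℝ) (i j k : Fin n) (x y : E n) : ℝ :=
  (1 / 2) * ∑ s, (fundamentalTensor F x y)⁻¹ i s *
    (dx k (fun x y => fundamentalTensor F x y s j) x y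
      - dx s (fun x y => fundamentalTensor F x y j k) x y
      + dx j (fun x y => fundamentalTensor F x y k s) x y)

/-- The spray coefficients `Gⁱ = ½ γⁱ_{jk} yʲ yᵏ`. -/
def spray (F : E n → E n → ℝ) (i : Fin n) (x y : E n) : ℝ :=
  (1 / 2) * ∑ j, ∑ k, christoffel F i j k x y * y j * y k

/-- The nonlinear connection `Nⁱ_j = ∂Gⁱ/∂yʲ`. -/
def nonlinearConnection (F : E n → E n → ℝ) (i j : Fin n) (x y : E n) : ℝ :=
  dy j (spray F i) x y

/-- The adapted derivative `δf/δxⁱ = ∂f/∂xⁱ - Nʲ_i ∂f/∂yʲ`. -/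
def delta (F : E n → E n → ℝ) (i : Fin n) (f : E n → E n → ℝ) (x y : E n) : ℝ :=
  dx i f x y - ∑ j, nonlinearConnection F j i x y * dy j f x y

/-- The Berwald connection coefficients `Γⁱ_{jk} = ∂Nⁱ_j/∂yᵏ`. -/
def berwald (F : E n → E n → ℝ) (i j k : Fin n) (x y : E n) : ℝ :=
  dy k (nonlinearConnection F i j) x y

/-- The Berwald `h`-curvature `curvature F j i k l = R_jⁱ_{kl}`, that is
`δΓⁱ_{jk}/δxˡ + Γʳ_{jk} Γⁱ_{rl} - (k ↔ l)`. -/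
def curvature (F : E n → E n → ℝ) (j i k l : Fin n) (x y : E n) : ℝ :=
  (delta F l (berwald F i j k) x y + ∑ r, berwald F r j k x y * berwald F i r l x y)
    - (delta F k (berwald F i j l) x y + ∑ r, berwald F r j l x y * berwald F i r k x y)

/-- The lowered curvature `R_{hijk} = g_{ir} R_hʳ_{jk}`. -/
def curvatureLow (F : E n → E n → ℝ) (h i j k : Fin n) (x y : E n) : ℝ :=
  ∑ r, fundamentalTensor F x y i r * curvature F h r j k x y

/-- The flag curvature
`K(x, y, X) = R_{hijk} yʰ Xⁱ yʲ Xᵏ / ((g_{hj} g_{ik} - g_{hk} g_{ij}) yʰ Xⁱ yʲ Xᵏ)`. -/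
def flagCurvature (F : E n → E n → ℝ) (x y X : E n) : ℝ :=
  (∑ h, ∑ i, ∑ j, ∑ k, curvatureLow F h i j k x y * y h * X i * y j * X k) /
    (∑ h, ∑ i, ∑ j, ∑ k,
      (fundamentalTensor F x y h j * fundamentalTensor F x y i k
        - fundamentalTensor F x y h k * fundamentalTensor F x y i j) * y h * X i * y j * X k)

/-- `F` is a conic Finsler metric on the open set `A ⊆ T𝔼ⁿ`: over every point the fibre `A_x` is a
(non-empty, open) conic domain, and `F` restricts to a smooth function on `A` that is on every
fibre a Minkowski conic norm, i.e. positive, positively homogeneous of degree one and with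
positive definite fundamental tensor. -/
structure IsConicFinslerMetric (A : Set (E n × E n)) (F : E n → E n → ℝ) : Prop where
  isOpen : IsOpen A
  nonempty : ∀ x, ∃ y, (x, y) ∈ A
  conic : ∀ x y, (x, y) ∈ A → ∀ c : ℝ, 0 < c → (x, c • y) ∈ A
  smooth : ContDiffOn ℝ ∞ (fun p : E n × E n => F p.1 p.2) A
  pos : ∀ x y, (x, y) ∈ A → 0 < F x y
  homogeneous : ∀ x y, (x, y) ∈ A → ∀ c : ℝ, 0 < c → F x (c • y) = c * F x y
  posDef : ∀ x y, (x, y) ∈ A → (fundamentalTensor F x y).PosDef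

/-- The conic Finsler space `(𝔼ⁿ, F : A → (0, ∞))` is of constant flag curvature `K`: the flag
curvature equals `K` for every flagpole `y ∈ A_x` and every transverse edge `X`. For linearly
independent `y`, `X` the denominator `g(y, y) g(X, X) - g(y, X)²` of the flag curvature is positive,
since `g` is positive definite. -/
def HasConstantFlagCurvature (A : Set (E n × E n)) (F : E n → E n → ℝ) (K : ℝ) : Prop :=
  IsConicFinslerMetric A F ∧
    ∀ x y X : E n, (x, y) ∈ A → LinearIndependent ℝ ![y, X] → flagCurvature F x y X = K

end ConicFinsler

/-! ### Kropina spaces and navigation data -/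

namespace Kropina

open ConicFinsler

variable {n : ℕ}

/-- `α(x, y) = √(a_{ij}(x) yⁱ yʲ)`. -/
def alpha (a : E n → Matrix (Fin n) (Fin n) ℝ) (x y : E n) : ℝ :=
  √(∑ i, ∑ j, a x i j * y i * y j)

/-- `β(x, y) = b_i(x) yⁱ`. -/
def beta (b : E n → Fin n → ℝ) (x y : E n) : ℝ :=
  ∑ i, b x i * y i

/-- The Kropina metric `F = α² / β`; it is considered on `domain b` only. -/
def metric (a : E n → Matrix (Fin n) (Fin n) ℝ) (b : E n → Fin n → ℝ) (x y : E n) : ℝ :=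
  alpha a x y ^ 2 / beta b x y

/-- The conic domain `A = {(x, y) : b_i(x) yⁱ > 0}` of a Kropina metric. -/
def domain (b : E n → Fin n → ℝ) : Set (E n × E n) :=
  {p | 0 < beta b p.1 p.2}

/-- `a_{ij} = e^{-k} h_{ij}`. -/
def navA (h : E n → Matrix (Fin n) (Fin n) ℝ) (k : E n → ℝ) (x : E n) :
    Matrix (Fin n) (Fin n) ℝ :=
  Real.exp (-k x) • h x

/-- `b_i = 2 e^{-k} W_i`, where `W_i = h_{ij} Wʲ`. -/
def navB (h : E n → Matrix (Fin n) (Fin n) ℝ) (k : E n → ℝ) (W : E n → E n) (x : E n)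
    (i : Fin n) : ℝ :=
  2 * Real.exp (-k x) * ∑ j, h x i j * W x j

/-- The flat metric `h_{ij} = δ_{ij}`. -/
def flat (n : ℕ) (_ : E n) : Matrix (Fin n) (Fin n) ℝ := 1

end Kropina

end

/-!
Up to the factor `e^{-k}`, which cancels, the metric is `F = |y|² / (2 ⟨W, y⟩)` (`navMetric`), on
the half spaces `⟨W, y⟩ > 0`. If `W` is constant then `F` does not depend on `x`, so its spray and
its curvature vanish (`flagCurvature_of_forall_eq`), and `F` is a conic Finsler metric because its
fundamental tensor is a sum of two squares (`sq_mul_navTensor_self`).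

Conversely, write `A = DW`. Since `|W| = 1`, `⟨A v, W⟩ = 0` for all `v`. The fundamental tensor is
computed in closed form, and so is the spray (`spray_navMetric`)
`G = -(|y|² / 4⟨W, y⟩) (A y - Aᵀ y + ⟨A W, y⟩ W) + ½ ⟨A y, y⟩ W + ½ ⟨A W, y⟩ y
  - (⟨W, y⟩ ⟨A y, y⟩ / |y|²) y`.
For any spray, contracting the Berwald curvature with the flagpole leaves an expression in first
and second derivatives of `G` (`sum_curvature_mul_mul`). The edge `X = W + (3 - 2 / |y|²) y` at a
point with `⟨W, y⟩ = 1` is special: its dual covector is a multiple of `⟨y, ·⟩`, and the summand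
along `y` does not contribute to the curvature. So vanishing flag curvature gives one scalar
equation `navCurvature W x y = 0`. Expanded in powers of `|y|²`, it reads, where `⟨W, y⟩ = 1`,
`0 = |y|⁴ navCurvature W x y = -3 ⟨A y, y⟩² + |y|² Q` with `Q` polynomial in `y`
(`navCurvature_expansion`). On the line `y = W + t e`, with `e` a unit vector orthogonal to `W`,
one has `|y|² = 1 + t²` and `⟨A y, y⟩ = t ⟨A W, e⟩ + t² ⟨A e, e⟩`; evaluating the identity at
`t = √-1` shows that `⟨A W, e⟩ = ⟨A e, e⟩ = 0`. Hence `A` is skew, that is, `W` is a Killing field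
(`inner_fderiv_self_eq_zero`). The second derivative of a Killing field of Euclidean space vanishes,
and differentiating `⟨A u, W⟩ = 0` then gives `|A u|² = 0` (`fderiv_eq_zero_of_killing`).
-/

open scoped RealInnerProductSpace

/-! ### Directional derivatives on the tangent bundle -/

namespace ConicFinsler

variable {n : ℕ}

/-- The derivative of `f (x, y)` at the point `(x, y)` of `T𝔼ⁿ` in the direction `(u, v)`. -/
noncomputable def dir (f : E n → E n → ℝ) (x y u v : E n) : ℝ :=
  fderiv ℝ (fun p : E n × E n => f p.1 p.2) (x, y) (u, v)

/-- Smoothness of a function `f (x, y)` on a set of `T𝔼ⁿ`. -/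
def SmoothOn (A : Set (E n × E n)) (f : E n → E n → ℝ) : Prop :=
  ContDiffOn ℝ ∞ (fun p : E n × E n => f p.1 p.2) A

theorem sum_map_single_mul {f : E n → ℝ} (hf : IsLinearMap ℝ f) (v : E n) :
    ∑ i, f (EuclideanSpace.single i 1) * v i = f v := by
  have h : v = ∑ i, v i • EuclideanSpace.single i (1 : ℝ) := by
    ext j
    simp [Finset.sum_apply, Pi.single_apply]
  have h2 : f v = hf.mk' f v := rfl
  rw [h2]
  conv_rhs => rw [h]
  rw [map_sum]
  refine Finset.sum_congr rfl fun i _ => ?_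
  rw [map_smul]
  simp [mul_comm]

section

variable {A : Set (E n × E n)} {f g : E n → E n → ℝ} {x y u v : E n}

theorem SmoothOn.differentiableAt (hf : SmoothOn A f) (hA : IsOpen A) (h : (x, y) ∈ A) :
    DifferentiableAt ℝ (fun p : E n × E n => f p.1 p.2) (x, y) :=
  (hf.contDiffAt (hA.mem_nhds h)).differentiableAt (by simp)

theorem SmoothOn.congr (hf : SmoothOn A f) (h : ∀ x y, (x, y) ∈ A → g x y = f x y) :
    SmoothOn A g :=
  ContDiffOn.congr hf fun p hp => h p.1 p.2 hp

theorem SmoothOn.dir (hf : SmoothOn A f) (hA : IsOpen A) (u v : E n) :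
    SmoothOn A fun x y => dir f x y u v := by
  have h : ContDiffOn ℝ ∞ (fderiv ℝ (fun p : E n × E n => f p.1 p.2)) A :=
    ContDiffOn.fderiv_of_isOpen hf hA (by simp)
  exact h.clm_apply contDiffOn_const

theorem dir_congr (hA : IsOpen A) (hp : (x, y) ∈ A) (h : ∀ x y, (x, y) ∈ A → f x y = g x y) :
    dir f x y u v = dir g x y u v := by
  have : (fun p : E n × E n => f p.1 p.2) =ᶠ[nhds (x, y)] fun p => g p.1 p.2 := by
    filter_upwards [hA.mem_nhds hp] with p hp using h p.1 p.2 hp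
  simp [dir, this.fderiv_eq]

theorem dx_eq_dir (hf : DifferentiableAt ℝ (fun p : E n × E n => f p.1 p.2) (x, y)) (i : Fin n) :
    dx i f x y = dir f x y (EuclideanSpace.single i 1) 0 := by
  have h2 : HasFDerivAt (fun x' => f x' y) _ x :=
    HasFDerivAt.comp (f := fun x' => (x', y)) x hf.hasFDerivAt
      ((hasFDerivAt_id x).prodMk (hasFDerivAt_const y x))
  rw [dx, h2.fderiv]
  simp [dir]

theorem dy_eq_dir (hf : DifferentiableAt ℝ (fun p : E n × E n => f p.1 p.2) (x, y)) (i : Fin n) :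
    dy i f x y = dir f x y 0 (EuclideanSpace.single i 1) := by
  have h2 : HasFDerivAt (fun y' => f x y') _ y :=
    HasFDerivAt.comp (f := fun y' => (x, y')) y hf.hasFDerivAt
      ((hasFDerivAt_const x y).prodMk (hasFDerivAt_id y))
  rw [dy, h2.fderiv]
  simp [dir]

/-- A directional derivative may be computed along any line. -/
theorem dir_eq_of_hasDerivAt
    (hf : DifferentiableAt ℝ (fun p : E n × E n => f p.1 p.2) (x, y)) {d : ℝ}
    (h : HasDerivAt (fun s : ℝ => f (x + s • u) (y + s • v)) d 0) : dir f x y u v = d := by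
  have hl : HasDerivAt (fun s : ℝ => ((x, y) : E n × E n) + s • (u, v)) (u, v) 0 := by
    simpa using ((hasDerivAt_id (0 : ℝ)).smul_const ((u, v) : E n × E n)).const_add (x, y)
  have hf' : HasFDerivAt (fun p : E n × E n => f p.1 p.2)
      (fderiv ℝ (fun p : E n × E n => f p.1 p.2) (x, y))
      ((fun s : ℝ => ((x, y) : E n × E n) + s • (u, v)) 0) := by
    simpa using hf.hasFDerivAt
  have h2 := hf'.comp_hasDerivAt (0 : ℝ) hl
  exact h2.unique h

theorem dir_add (f : E n → E n → ℝ) (x y u v u' v' : E n) :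
    dir f x y (u + u') (v + v') = dir f x y u v + dir f x y u' v' := by
  simp only [dir, ← map_add, Prod.mk_add_mk]

theorem dir_smul (f : E n → E n → ℝ) (x y u v : E n) (c : ℝ) :
    dir f x y (c • u) (c • v) = c * dir f x y u v := by
  simp only [dir, ← smul_eq_mul, ← map_smul, Prod.smul_mk]

theorem isLinearMap_dir_right (f : E n → E n → ℝ) (x y : E n) :
    IsLinearMap ℝ fun v => dir f x y 0 v :=
  ⟨fun v w => by simpa using dir_add f x y 0 v 0 w, fun c v => by
    simpa using dir_smul f x y 0 v c⟩

theorem isLinearMap_dir_left (f : E n → E n → ℝ) (x y : E n) :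
    IsLinearMap ℝ fun u => dir f x y u 0 :=
  ⟨fun v w => by simpa using dir_add f x y v 0 w 0, fun c v => by
    simpa using dir_smul f x y v 0 c⟩

theorem dir_eq_add (f : E n → E n → ℝ) (x y u v : E n) :
    dir f x y u v = dir f x y u 0 + dir f x y 0 v := by
  simpa using dir_add f x y u 0 0 v

/-- Product rule for `∑ f_h (x, y) yʰ`. -/
theorem dir_sum_mul_coord {f : Fin n → E n → E n → ℝ}
    (hf : ∀ h, DifferentiableAt ℝ (fun p : E n × E n => f h p.1 p.2) (x, y)) :
    dir (fun x y => ∑ h, f h x y * y h) x y u v =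
      ∑ h, (dir (f h) x y u v * y h + f h x y * v h) := by
  have hc : ∀ i : Fin n, HasFDerivAt (fun p : E n × E n => p.2 i)
      ((EuclideanSpace.proj i : E n →L[ℝ] ℝ).comp (ContinuousLinearMap.snd ℝ (E n) (E n)))
      (x, y) := fun i =>
    ((EuclideanSpace.proj i : E n →L[ℝ] ℝ).comp
      (ContinuousLinearMap.snd ℝ (E n) (E n))).hasFDerivAt
  have h := HasFDerivAt.fun_sum (u := Finset.univ)
    fun h _ => (hf h).hasFDerivAt.fun_mul (hc h)
  rw [dir, h.fderiv]
  simp only [sum_apply]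
  refine Finset.sum_congr rfl fun h _ => ?_
  simp [dir]
  ring

theorem dir_sum_mul_const {ι : Type*} [Fintype ι] {f : ι → E n → E n → ℝ} (c : ι → ℝ)
    (hf : ∀ h, DifferentiableAt ℝ (fun p : E n × E n => f h p.1 p.2) (x, y)) :
    dir (fun x y => ∑ h, f h x y * c h) x y u v = ∑ h, dir (f h) x y u v * c h := by
  have h := HasFDerivAt.fun_sum (u := Finset.univ)
    fun h _ => (hf h).hasFDerivAt.mul_const (c h)
  rw [dir, h.fderiv]
  simp only [sum_apply]
  refine Finset.sum_congr rfl fun h _ => ?_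
  simp [dir, mul_comm]

end

/-! ### The Berwald curvature of a spray -/

section Berwald

variable {A : Set (E n × E n)} {F f : E n → E n → ℝ} {x y : E n}

theorem delta_eq_dir (hf : DifferentiableAt ℝ (fun p : E n × E n => f p.1 p.2) (x, y))
    (i : Fin n) :
    delta F i f x y = dir f x y (EuclideanSpace.single i 1)
      (-WithLp.toLp 2 fun j => nonlinearConnection F j i x y) := by
  have h := sum_map_single_mul (isLinearMap_dir_right f x y)
    (WithLp.toLp 2 fun j => nonlinearConnection F j i x y)
  rw [delta, dir_eq_add, (isLinearMap_dir_right f x y).map_neg, ← h, dx_eq_dir hf, sub_eq_add_neg]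
  simp only [dy_eq_dir hf, mul_comm]

/-- The vector `Gⁱ` of spray coefficients. -/
noncomputable def sprayVector (F : E n → E n → ℝ) (x y : E n) : E n :=
  WithLp.toLp 2 fun i => spray F i x y

section Contraction

variable (hA : IsOpen A) (hS : ∀ i, SmoothOn A (spray F i))

include hA hS

theorem nonlinearConnection_eq_dir (hp : (x, y) ∈ A) (i j : Fin n) :
    nonlinearConnection F i j x y = dir (spray F i) x y 0 (EuclideanSpace.single j 1) :=
  dy_eq_dir ((hS i).differentiableAt hA hp) j

theorem smoothOn_nonlinearConnection (i j : Fin n) : SmoothOn A (nonlinearConnection F i j) :=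
  ((hS i).dir hA 0 (EuclideanSpace.single j 1)).congr fun _ _ hp =>
    nonlinearConnection_eq_dir hA hS hp i j

theorem berwald_eq_dir (hp : (x, y) ∈ A) (i j k : Fin n) :
    berwald F i j k x y = dir (nonlinearConnection F i j) x y 0 (EuclideanSpace.single k 1) :=
  dy_eq_dir ((smoothOn_nonlinearConnection hA hS i j).differentiableAt hA hp) k

theorem smoothOn_berwald (i j k : Fin n) : SmoothOn A (berwald F i j k) :=
  ((smoothOn_nonlinearConnection hA hS i j).dir hA 0 (EuclideanSpace.single k 1)).congr
    fun _ _ hp => berwald_eq_dir hA hS hp i j k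

variable (hE : ∀ i x y, (x, y) ∈ A → ∑ j, nonlinearConnection F i j x y * y j = 2 * spray F i x y)

include hE

/-- Euler's identity for the nonlinear connection, from that for the spray. -/
theorem sum_berwald_mul (hp : (x, y) ∈ A) (i k : Fin n) :
    ∑ h, berwald F i h k x y * y h = nonlinearConnection F i k x y := by
  have h1 : dir (fun x y => ∑ h, nonlinearConnection F i h x y * y h) x y 0
      (EuclideanSpace.single k 1) = dir (fun x y => ∑ _h : Fin 1, spray F i x y * 2) x y 0
      (EuclideanSpace.single k 1) :=
    dir_congr hA hp fun x y hp => by rw [hE i x y hp]; simp [mul_comm]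
  rw [dir_sum_mul_coord fun h =>
    (smoothOn_nonlinearConnection hA hS i h).differentiableAt hA hp,
    dir_sum_mul_const (fun _ => 2) fun _ => (hS i).differentiableAt hA hp,
    Finset.sum_add_distrib] at h1
  simp only [← berwald_eq_dir hA hS hp, ← nonlinearConnection_eq_dir hA hS hp] at h1
  simp at h1
  linarith

theorem sum_delta_berwald_mul (hp : (x, y) ∈ A) (i k l : Fin n) :
    ∑ h, delta F l (berwald F i h k) x y * y h =
      delta F l (nonlinearConnection F i k) x y +
        ∑ h, berwald F i h k x y * nonlinearConnection F h l x y := by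
  have hN := (smoothOn_nonlinearConnection hA hS i k).differentiableAt hA hp
  have hB : ∀ h, DifferentiableAt ℝ (fun p : E n × E n => berwald F i h k p.1 p.2) (x, y) :=
    fun h => (smoothOn_berwald hA hS i h k).differentiableAt hA hp
  rw [delta_eq_dir hN, dir_congr hA hp (g := fun x y => ∑ h, berwald F i h k x y * y h)
    fun x y hp => (sum_berwald_mul hA hS hE hp i k).symm, dir_sum_mul_coord hB,
    Finset.sum_add_distrib]
  simp only [delta_eq_dir (hB _)]
  simp

theorem sum_delta_nonlinearConnection_mul (hp : (x, y) ∈ A) (i l : Fin n) :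
    ∑ h, delta F l (nonlinearConnection F i h) x y * y h =
      2 * delta F l (spray F i) x y +
        ∑ h, nonlinearConnection F i h x y * nonlinearConnection F h l x y := by
  have hN : ∀ h, DifferentiableAt ℝ
      (fun p : E n × E n => nonlinearConnection F i h p.1 p.2) (x, y) :=
    fun h => (smoothOn_nonlinearConnection hA hS i h).differentiableAt hA hp
  have h1 : dir (fun x y => ∑ h, nonlinearConnection F i h x y * y h) x y
      (EuclideanSpace.single l 1) (-WithLp.toLp 2 fun j => nonlinearConnection F j l x y) =
      dir (fun x y => ∑ _h : Fin 1, spray F i x y * 2) x y (EuclideanSpace.single l 1)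
        (-WithLp.toLp 2 fun j => nonlinearConnection F j l x y) :=
    dir_congr hA hp fun x y hp => by rw [hE i x y hp]; simp [mul_comm]
  rw [dir_sum_mul_coord hN,
    dir_sum_mul_const (fun _ => 2) fun _ => (hS i).differentiableAt hA hp,
    Finset.sum_add_distrib] at h1
  simp only [← delta_eq_dir ((hS i).differentiableAt hA hp), ← delta_eq_dir (hN _)] at h1
  simp at h1
  linarith

/-- The `h`-curvature contracted with the flagpole is the curvature of the nonlinear connection. -/
theorem sum_curvature_mul (hp : (x, y) ∈ A) (r j k : Fin n) :
    ∑ h, curvature F h r j k x y * y h =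
      delta F k (nonlinearConnection F r j) x y - delta F j (nonlinearConnection F r k) x y := by
  have key : ∀ j k, ∑ h, (∑ m, berwald F m h j x y * berwald F r m k x y) * y h =
      ∑ m, nonlinearConnection F m j x y * berwald F r m k x y := by
    intro j k
    simp only [Finset.sum_mul]
    rw [Finset.sum_comm]
    refine Finset.sum_congr rfl fun m _ => ?_
    rw [← sum_berwald_mul hA hS hE hp m j, Finset.sum_mul]
    exact Finset.sum_congr rfl fun h _ => by ring
  simp only [curvature, sub_mul, add_mul, Finset.sum_sub_distrib, Finset.sum_add_distrib, key,
    sum_delta_berwald_mul hA hS hE hp]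
  simp only [mul_comm]
  ring

/-- The curvature of the flag spanned by the flagpole `y` and the edge `X`, that is
`2 X(Gʳ) - S(Nʳ(X)) - Nʳ(N(X))` where `S = y ∂/∂x - 2 G ∂/∂y` is the geodesic spray. -/
theorem sum_curvature_mul_mul (hp : (x, y) ∈ A) (r : Fin n) (X : E n) :
    ∑ h, ∑ j, ∑ k, curvature F h r j k x y * y h * y j * X k =
      2 * dir (spray F r) x y X 0
        - dir (fun x y => dir (spray F r) x y 0 X) x y y ((-2 : ℝ) • sprayVector F x y)
        - dir (spray F r) x y 0 (WithLp.toLp 2 fun m => dir (spray F m) x y 0 X) := by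
  have hSd := fun i => (hS i).differentiableAt hA hp
  have hNd := fun i j => (smoothOn_nonlinearConnection hA hS i j).differentiableAt hA hp
  -- the vector `N(v)` for a tangent vector `v`
  have hNv : ∀ (v : E n) (m : Fin n), ∑ k, nonlinearConnection F m k x y * v k =
      dir (spray F m) x y 0 v := fun v m => by
    simp only [nonlinearConnection_eq_dir hA hS hp]
    exact sum_map_single_mul (isLinearMap_dir_right (spray F m) x y) v
  have h1 : ∑ h, ∑ j, ∑ k, curvature F h r j k x y * y h * y j * X k =
      ∑ k, ∑ j, (delta F k (nonlinearConnection F r j) x y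
        - delta F j (nonlinearConnection F r k) x y) * y j * X k := by
    simp only [← sum_curvature_mul hA hS hE hp, Finset.sum_mul]
    rw [Finset.sum_comm]
    conv_rhs => rw [Finset.sum_comm]
    refine Finset.sum_congr rfl fun j _ => ?_
    rw [Finset.sum_comm]
  have h2 : ∑ k, delta F k (spray F r) x y * X k = dir (spray F r) x y X 0
      - dir (spray F r) x y 0 (WithLp.toLp 2 fun m => dir (spray F m) x y 0 X) := by
    have e1 := sum_map_single_mul (isLinearMap_dir_left (spray F r) x y) X
    have e2 := hNv (WithLp.toLp 2 fun m => dir (spray F m) x y 0 X) r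
    rw [← e1, ← e2]
    simp only [delta, dx_eq_dir (hSd r), ← hNv X, sub_mul, Finset.sum_sub_distrib]
    congr 1
    simp only [Finset.sum_mul, Finset.mul_sum]
    rw [Finset.sum_comm]
    refine Finset.sum_congr rfl fun m _ => Finset.sum_congr rfl fun k _ => ?_
    rw [show dy m (spray F r) x y = nonlinearConnection F r m x y from rfl]
    ring
  have h3 : ∑ k, (∑ h, nonlinearConnection F r h x y * nonlinearConnection F h k x y) * X k =
      dir (spray F r) x y 0 (WithLp.toLp 2 fun m => dir (spray F m) x y 0 X) := by
    rw [← hNv]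
    simp only [Finset.sum_mul, ← hNv X, Finset.mul_sum]
    rw [Finset.sum_comm]
    exact Finset.sum_congr rfl fun m _ => Finset.sum_congr rfl fun k _ => by ring
  have h4 : ∀ k, ∑ j, delta F j (nonlinearConnection F r k) x y * y j =
      dir (nonlinearConnection F r k) x y y ((-2 : ℝ) • sprayVector F x y) := by
    intro k
    have e1 := sum_map_single_mul (isLinearMap_dir_left (nonlinearConnection F r k) x y) y
    have e2 := sum_map_single_mul (isLinearMap_dir_right (nonlinearConnection F r k) x y)
      ((-2 : ℝ) • sprayVector F x y)
    rw [dir_eq_add, ← e1, ← e2]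
    simp only [delta, dx_eq_dir (hNd r k), dy_eq_dir (hNd r k), sub_eq_add_neg, add_mul,
      Finset.sum_add_distrib, neg_mul]
    congr 1
    simp only [Finset.sum_mul]
    rw [Finset.sum_neg_distrib, Finset.sum_comm, ← Finset.sum_neg_distrib]
    refine Finset.sum_congr rfl fun m _ => ?_
    have e3 := hE m x y hp
    simp only [PiLp.smul_apply, sprayVector, smul_eq_mul]
    have e4 : (-2 : ℝ) * spray F m x y = -∑ j, nonlinearConnection F m j x y * y j := by
      rw [e3]; ring
    rw [e4, mul_neg, Finset.mul_sum]
    congr 1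
    exact Finset.sum_congr rfl fun k _ => by ring
  have h5 : ∑ k, dir (nonlinearConnection F r k) x y y ((-2 : ℝ) • sprayVector F x y) * X k =
      dir (fun x y => dir (spray F r) x y 0 X) x y y ((-2 : ℝ) • sprayVector F x y) := by
    rw [← dir_sum_mul_const (fun k => X k) (hNd r)]
    refine dir_congr hA hp fun x y hp => ?_
    simp only [nonlinearConnection_eq_dir hA hS hp]
    exact sum_map_single_mul (isLinearMap_dir_right (spray F r) x y) X
  rw [h1]
  simp only [sub_mul, Finset.sum_sub_distrib, ← Finset.sum_mul, h4, h5,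
    sum_delta_nonlinearConnection_mul hA hS hE hp, add_mul, Finset.sum_add_distrib, h3]
  simp only [mul_assoc, ← Finset.mul_sum, h2]
  ring

end Contraction

theorem curvature_antisymm (h i j k : Fin n) (x y : E n) :
    curvature F h i k j x y = -curvature F h i j k x y := by
  simp only [curvature]; ring

end Berwald

/-- A metric that does not depend on `x` is flat. -/
theorem flagCurvature_of_forall_eq {F : E n → E n → ℝ} {f : E n → ℝ} (hF : ∀ x, F x = f)
    (x y X : E n) : flagCurvature F x y X = 0 := by
  obtain rfl : F = fun _ => f := funext hF
  have h1 : ∀ i j k x y, dx k (fun x y => fundamentalTensor (fun _ : E n => f) x y i j) x y = 0 := by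
    intro i j k x y
    change fderiv ℝ (fun _ : E n => fundamentalTensor (fun _ : E n => f) x y i j) x _ = 0
    simp
  have h2 : ∀ i, spray (fun _ : E n => f) i = fun _ _ => 0 := fun i => by
    funext x y
    simp [spray, christoffel, h1]
  have h3 : ∀ i j, nonlinearConnection (fun _ : E n => f) i j = fun _ _ => 0 := fun i j => by
    funext x y
    simp [nonlinearConnection, h2, dy]
  have h4 : ∀ i j k, berwald (fun _ : E n => f) i j k = fun _ _ => 0 := fun i j k => by
    funext x y
    simp [berwald, h3, dy]
  simp [flagCurvature, curvatureLow, curvature, h4, delta, dx, dy]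

end ConicFinsler

/-! ### Polynomial functions of one real variable -/

section PolynomialFunctions

open Polynomial

/-- Real functions of one variable given by a polynomial. -/
def IsPolynomialFun (f : ℝ → ℝ) : Prop := ∃ p : ℝ[X], ∀ t, f t = p.eval t

namespace IsPolynomialFun

variable {f g : ℝ → ℝ}

theorem const (c : ℝ) : IsPolynomialFun fun _ => c := ⟨C c, by simp⟩

theorem id : IsPolynomialFun fun t => t := ⟨X, by simp⟩

theorem add (hf : IsPolynomialFun f) (hg : IsPolynomialFun g) :
    IsPolynomialFun fun t => f t + g t := by
  obtain ⟨p, hp⟩ := hf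
  obtain ⟨q, hq⟩ := hg
  exact ⟨p + q, by simp [hp, hq]⟩

theorem mul (hf : IsPolynomialFun f) (hg : IsPolynomialFun g) :
    IsPolynomialFun fun t => f t * g t := by
  obtain ⟨p, hp⟩ := hf
  obtain ⟨q, hq⟩ := hg
  exact ⟨p * q, by simp [hp, hq]⟩

theorem neg (hf : IsPolynomialFun f) : IsPolynomialFun fun t => -f t := by
  obtain ⟨p, hp⟩ := hf
  exact ⟨-p, by simp [hp]⟩

theorem sub (hf : IsPolynomialFun f) (hg : IsPolynomialFun g) :
    IsPolynomialFun fun t => f t - g t := by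
  simpa only [sub_eq_add_neg] using hf.add hg.neg

/-- If `1 + t²` divides `3 (κ t + μ t²)²`, then `κ = μ = 0`, as one sees at `t = √-1`. -/
theorem eq_zero_of_one_add_sq_dvd {κ μ : ℝ} (hf : IsPolynomialFun f)
    (h : ∀ t ≠ 0, -3 * (t * κ + t ^ 2 * μ) ^ 2 + (1 + t ^ 2) * f t = 0) : κ = 0 ∧ μ = 0 := by
  obtain ⟨q, hq⟩ := hf
  have h0 : -3 * (X * C κ + X ^ 2 * C μ) ^ 2 + (1 + X ^ 2) * q = 0 := by
    refine Polynomial.eq_zero_of_infinite_isRoot _ ((Set.Ioi_infinite (0 : ℝ)).mono fun t ht => ?_)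
    have := h t (ne_of_gt ht)
    rw [hq] at this
    change eval t _ = 0
    simp only [eval_add, eval_mul, eval_pow, eval_neg, eval_X, eval_C, eval_one, eval_ofNat]
    exact this
  have h1 := congrArg (aeval Complex.I) h0
  simp only [map_add, map_mul, map_neg, map_pow, aeval_X, aeval_C, map_one, Complex.I_sq,
    add_neg_cancel, zero_mul, add_zero, map_ofNat, map_zero] at h1
  have h2 : Complex.I * (κ : ℂ) + -1 * (μ : ℂ) = 0 := by simpa using h1
  have hre := congrArg Complex.re h2
  have him := congrArg Complex.im h2
  simp at hre him
  exact ⟨him, hre⟩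

end IsPolynomialFun

end PolynomialFunctions

/-! ### The fundamental tensor of the Kropina metric -/

namespace Kropina

open ConicFinsler

variable {n : ℕ}

/-- The factor `e^{-k}` cancels, also where `⟨W, y⟩ = 0` and both sides are junk. -/
theorem metric_flat (k : E n → ℝ) (W : E n → E n) :
    metric (navA (flat n) k) (navB (flat n) k W) = fun x y => ⟪y, y⟫ / (2 * ⟪W x, y⟫) := by
  funext x y
  have hb : beta (navB (flat n) k W) x y = Real.exp (-k x) * (2 * ⟪W x, y⟫) := by
    simp only [beta, navB, flat, Matrix.one_apply, PiLp.inner_apply, Finset.mul_sum]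
    refine Finset.sum_congr rfl fun i _ => ?_
    simp
    ring
  have ha : alpha (navA (flat n) k) x y ^ 2 = Real.exp (-k x) * ⟪y, y⟫ := by
    have h : ∑ i, ∑ j, navA (flat n) k x i j * y i * y j = Real.exp (-k x) * ⟪y, y⟫ := by
      simp only [navA, flat, PiLp.inner_apply, Finset.mul_sum]
      refine Finset.sum_congr rfl fun i _ => ?_
      simp [Matrix.one_apply]
      ring
    rw [alpha, h, Real.sq_sqrt (mul_nonneg (Real.exp_nonneg _) real_inner_self_nonneg)]
  rw [metric, ha, hb, mul_div_mul_left _ _ (Real.exp_ne_zero _)]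

theorem domain_flat (k : E n → ℝ) (W : E n → E n) :
    domain (navB (flat n) k W) = {p : E n × E n | 0 < ⟪W p.1, p.2⟫} := by
  ext p
  have hb : beta (navB (flat n) k W) p.1 p.2 = 2 * Real.exp (-k p.1) * ⟪W p.1, p.2⟫ := by
    simp only [beta, navB, flat, Matrix.one_apply, PiLp.inner_apply, Finset.mul_sum]
    refine Finset.sum_congr rfl fun i _ => ?_
    simp
    ring
  have h : 0 < 2 * Real.exp (-k p.1) := by positivity
  simp only [domain, Set.mem_ofPred_eq, hb]
  exact mul_pos_iff_of_pos_left h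

/-- The Kropina metric `|y|² / (2 ⟨W, y⟩)` with navigation data the Euclidean metric and `W`. -/
noncomputable def navMetric (W : E n → E n) (x y : E n) : ℝ := ⟪y, y⟫ / (2 * ⟪W x, y⟫)

/-- The half space `⟨W, y⟩ > 0` in every tangent space. -/
def halfSpace (W : E n → E n) : Set (E n × E n) := {p | 0 < ⟪W p.1, p.2⟫}

/-- The fundamental tensor of `navMetric W`, as a bilinear form. -/
noncomputable def navTensor (W : E n → E n) (x y u v : E n) : ℝ :=
  ⟪y, y⟫ * ⟪u, v⟫ / (2 * ⟪W x, y⟫ ^ 2) + ⟪y, u⟫ * ⟪y, v⟫ / ⟪W x, y⟫ ^ 2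
    - ⟪y, y⟫ * (⟪y, u⟫ * ⟪W x, v⟫ + ⟪y, v⟫ * ⟪W x, u⟫) / ⟪W x, y⟫ ^ 3
    + 3 * ⟪y, y⟫ ^ 2 * ⟪W x, u⟫ * ⟪W x, v⟫ / (4 * ⟪W x, y⟫ ^ 4)

/-- The derivative of `navTensor W` with respect to `x` in the direction `l`. -/
noncomputable def navTensorDeriv (W : E n → E n) (x y l u v : E n) : ℝ :=
  -(⟪y, y⟫ * ⟪u, v⟫ * ⟪fderiv ℝ W x l, y⟫ / ⟪W x, y⟫ ^ 3)
    - 2 * ⟪y, u⟫ * ⟪y, v⟫ * ⟪fderiv ℝ W x l, y⟫ / ⟪W x, y⟫ ^ 3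
    - ⟪y, y⟫ * (⟪y, u⟫ * ⟪fderiv ℝ W x l, v⟫ + ⟪y, v⟫ * ⟪fderiv ℝ W x l, u⟫) / ⟪W x, y⟫ ^ 3
    + 3 * ⟪y, y⟫ * (⟪y, u⟫ * ⟪W x, v⟫ + ⟪y, v⟫ * ⟪W x, u⟫) * ⟪fderiv ℝ W x l, y⟫ / ⟪W x, y⟫ ^ 4
    + 3 * ⟪y, y⟫ ^ 2 * (⟪fderiv ℝ W x l, u⟫ * ⟪W x, v⟫ + ⟪W x, u⟫ * ⟪fderiv ℝ W x l, v⟫)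
      / (4 * ⟪W x, y⟫ ^ 4)
    - 3 * ⟪y, y⟫ ^ 2 * ⟪W x, u⟫ * ⟪W x, v⟫ * ⟪fderiv ℝ W x l, y⟫ / ⟪W x, y⟫ ^ 5

/-- The inner product with `z` of the spray vector of `navMetric W`. -/
noncomputable def navSpray (W : E n → E n) (z x y : E n) : ℝ :=
  -(⟪y, y⟫ / (4 * ⟪W x, y⟫)) * (⟪fderiv ℝ W x y, z⟫ - ⟪fderiv ℝ W x z, y⟫
      + ⟪fderiv ℝ W x (W x), y⟫ * ⟪W x, z⟫)
    + ⟪fderiv ℝ W x y, y⟫ * ⟪W x, z⟫ / 2 + ⟪fderiv ℝ W x (W x), y⟫ * ⟪y, z⟫ / 2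
    - ⟪W x, y⟫ * ⟪fderiv ℝ W x y, y⟫ / ⟪y, y⟫ * ⟪y, z⟫

variable {W : E n → E n} {x y : E n}

theorem isOpen_halfSpace (hW : ContDiff ℝ ∞ W) : IsOpen (halfSpace W) := by
  have h : Continuous W := hW.continuous
  exact isOpen_lt continuous_const (by fun_prop)

theorem inner_self_ne_zero_of_mem (h : ⟪W x, y⟫ ≠ 0) : ⟪y, y⟫ ≠ 0 := by
  intro h0
  rw [inner_self_eq_zero] at h0
  simp [h0] at h

theorem smooth_fderiv (hW : ContDiff ℝ ∞ W) : ContDiff ℝ ∞ (fderiv ℝ W) :=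
  hW.fderiv_right (by simp)

theorem smoothOn_inner_right (z : E n) (hW : ContDiff ℝ ∞ W) :
    SmoothOn (halfSpace W) fun x _ => ⟪W x, z⟫ :=
  ((hW.comp contDiff_fst).inner ℝ contDiff_const).contDiffOn

theorem smoothOn_inner (hW : ContDiff ℝ ∞ W) : SmoothOn (halfSpace W) fun x y => ⟪W x, y⟫ :=
  ((hW.comp contDiff_fst).inner ℝ contDiff_snd).contDiffOn

theorem smoothOn_inner_self : SmoothOn (halfSpace W) fun _ y => ⟪y, y⟫ :=
  (contDiff_snd.inner ℝ contDiff_snd).contDiffOn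

theorem smoothOn_navMetric (hW : ContDiff ℝ ∞ W) : SmoothOn (halfSpace W) (navMetric W) := by
  have h1 := smoothOn_inner hW
  have h2 := smoothOn_inner_self (W := W)
  unfold SmoothOn at *
  refine ContDiffOn.div h2 (contDiffOn_const.mul h1) fun p hp => ?_
  have : 0 < ⟪W p.1, p.2⟫ := hp
  positivity

theorem smoothOn_navMetric_sq (hW : ContDiff ℝ ∞ W) :
    SmoothOn (halfSpace W) fun x y => navMetric W x y ^ 2 / 2 :=
  ContDiffOn.div_const (ContDiffOn.pow (smoothOn_navMetric hW) 2) 2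

theorem smoothOn_navSpray (hW : ContDiff ℝ ∞ W) (z : E n) :
    SmoothOn (halfSpace W) (navSpray W z) := by
  have h1 := smoothOn_inner hW
  have h2 := smoothOn_inner_self (W := W)
  have h3 := smoothOn_inner_right z hW
  have hA : ContDiff ℝ ∞ fun p : E n × E n => fderiv ℝ W p.1 :=
    (smooth_fderiv hW).comp contDiff_fst
  have hp : ∀ {f : E n × E n → E n}, ContDiff ℝ ∞ f → ∀ v : E n × E n → E n, ContDiff ℝ ∞ v →
      ContDiffOn ℝ ∞ (fun p => ⟪fderiv ℝ W p.1 (f p), v p⟫) (halfSpace W) := fun hf v hv =>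
    ((hA.clm_apply hf).inner ℝ hv).contDiffOn
  have h4 := hp contDiff_snd (fun _ => z) contDiff_const
  have h5 := hp (f := fun _ => z) contDiff_const Prod.snd contDiff_snd
  have h6 := hp (hW.comp contDiff_fst) Prod.snd contDiff_snd
  have h7 := hp contDiff_snd Prod.snd contDiff_snd
  have h8 : ContDiffOn ℝ ∞ (fun p : E n × E n => ⟪p.2, z⟫) (halfSpace W) :=
    (contDiff_snd.inner ℝ contDiff_const).contDiffOn
  unfold SmoothOn at *
  have hb : ∀ p ∈ halfSpace W, 4 * ⟪W p.1, p.2⟫ ≠ 0 := fun p hp => by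
    have : 0 < ⟪W p.1, p.2⟫ := hp
    positivity
  have ha : ∀ p ∈ halfSpace W, ⟪p.2, p.2⟫ ≠ 0 := fun p hp =>
    inner_self_ne_zero_of_mem (x := p.1) (ne_of_gt hp)
  exact ((((h2.div (contDiffOn_const.mul h1) hb).neg.mul ((h4.sub h5).add (h6.mul h3))).add
    ((h7.mul h3).div_const 2)).add ((h6.mul h8).div_const 2)).sub
    (((h1.mul h7).div h2 ha).mul h8)

theorem hasDerivAt_line (x u : E n) : HasDerivAt (fun s : ℝ => x + s • u) u 0 := by
  simpa using ((hasDerivAt_id (0 : ℝ)).smul_const u).const_add x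

theorem hasDerivAt_comp_line {G : Type*} [NormedAddCommGroup G] [NormedSpace ℝ G] {f : E n → G}
    {x : E n} (hf : DifferentiableAt ℝ f x) (u : E n) :
    HasDerivAt (fun s : ℝ => f (x + s • u)) (fderiv ℝ f x u) 0 := by
  have h : HasFDerivAt f (fderiv ℝ f x) ((fun s : ℝ => x + s • u) 0) := by
    simpa using hf.hasFDerivAt
  exact h.comp_hasDerivAt (0 : ℝ) (hasDerivAt_line x u)


theorem dir_navMetric_sq (hW : ContDiff ℝ ∞ W) (hp : (x, y) ∈ halfSpace W) (v : E n) :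
    dir (fun x y => navMetric W x y ^ 2 / 2) x y 0 v =
      ⟪y, v⟫ * ⟪y, y⟫ / (2 * ⟪W x, y⟫ ^ 2) - ⟪y, y⟫ ^ 2 * ⟪W x, v⟫ / (4 * ⟪W x, y⟫ ^ 3) := by
  have hb : ⟪W x, y⟫ ≠ 0 := ne_of_gt hp
  refine dir_eq_of_hasDerivAt ((smoothOn_navMetric_sq hW).differentiableAt (isOpen_halfSpace hW) hp)
    ?_
  have hy := hasDerivAt_line y v
  have h1 := hy.inner ℝ hy
  have h2 := (hasDerivAt_const (0 : ℝ) (W x)).inner ℝ hy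
  have h3 := ((h1.fun_div (h2.const_mul 2) (by simpa using hb)).fun_pow 2).div_const 2
  simp only [navMetric, smul_zero, add_zero]
  refine h3.congr_deriv ?_
  simp only [zero_smul, add_zero, inner_zero_left, real_inner_comm y v, Nat.add_one_sub_one,
    pow_one, Nat.cast_ofNat]
  field_simp
  ring

theorem dir_dir_navMetric_sq (hW : ContDiff ℝ ∞ W) (hp : (x, y) ∈ halfSpace W) (u v : E n) :
    dir (fun x y => dir (fun x y => navMetric W x y ^ 2 / 2) x y 0 v) x y 0 u =
      navTensor W x y u v := by
  have hb : ⟪W x, y⟫ ≠ 0 := ne_of_gt hp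
  have hA := isOpen_halfSpace hW
  have hs : SmoothOn (halfSpace W) _ := (smoothOn_navMetric_sq hW).dir hA 0 v
  have hs' := hs.congr fun x y hp => (dir_navMetric_sq hW hp v).symm
  rw [dir_congr hA hp fun x y hp => dir_navMetric_sq hW hp v]
  refine dir_eq_of_hasDerivAt (hs'.differentiableAt hA hp) ?_
  have hy := hasDerivAt_line y u
  have h1 := hy.inner ℝ hy
  have h2 := (hasDerivAt_const (0 : ℝ) (W x)).inner ℝ hy
  have h3 := hy.inner ℝ (hasDerivAt_const (0 : ℝ) v)
  have h4 := ((h3.fun_mul h1).fun_div ((h2.fun_pow 2).const_mul 2) (by simpa using hb)).fun_sub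
    (((h1.fun_pow 2).mul_const ⟪W x, v⟫).fun_div ((h2.fun_pow 3).const_mul 4) (by simpa using hb))
  simp only [smul_zero, add_zero]
  refine h4.congr_deriv ?_
  simp only [zero_smul, add_zero, inner_zero_left, inner_zero_right, real_inner_comm y u, navTensor]
  field_simp
  ring

theorem fundamentalTensor_navMetric (hW : ContDiff ℝ ∞ W) (hp : (x, y) ∈ halfSpace W)
    (i j : Fin n) :
    fundamentalTensor (navMetric W) x y i j =
      navTensor W x y (EuclideanSpace.single i 1) (EuclideanSpace.single j 1) := by
  have hA := isOpen_halfSpace hW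
  have hs := smoothOn_navMetric_sq hW
  have h : ∀ x y, (x, y) ∈ halfSpace W → dy j (fun x y => navMetric W x y ^ 2 / 2) x y =
      dir (fun x y => navMetric W x y ^ 2 / 2) x y 0 (EuclideanSpace.single j 1) :=
    fun x y hp => dy_eq_dir (hs.differentiableAt hA hp) j
  have hs' := (hs.dir hA 0 (EuclideanSpace.single j 1)).congr h
  rw [fundamentalTensor, Matrix.of_apply, dy_eq_dir (hs'.differentiableAt hA hp),
    dir_congr hA hp h, dir_dir_navMetric_sq hW hp]

theorem smoothOn_navTensor (hW : ContDiff ℝ ∞ W) (u v : E n) :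
    SmoothOn (halfSpace W) fun x y => navTensor W x y u v :=
  (((smoothOn_navMetric_sq hW).dir (isOpen_halfSpace hW) 0 v).dir (isOpen_halfSpace hW) 0 u).congr
    fun _ _ hp => (dir_dir_navMetric_sq hW hp u v).symm

theorem dir_navTensor (hW : ContDiff ℝ ∞ W) (hp : (x, y) ∈ halfSpace W) (l u v : E n) :
    dir (fun x y => navTensor W x y u v) x y l 0 = navTensorDeriv W x y l u v := by
  have hb : ⟪W x, y⟫ ≠ 0 := ne_of_gt hp
  have hA := isOpen_halfSpace hW
  refine dir_eq_of_hasDerivAt ((smoothOn_navTensor hW u v).differentiableAt hA hp) ?_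
  have hw := hasDerivAt_comp_line (x := x) (hW.differentiable (by simp) x) l
  have h1 := hw.inner ℝ (hasDerivAt_const (0 : ℝ) y)
  have h2 := hw.inner ℝ (hasDerivAt_const (0 : ℝ) u)
  have h3 := hw.inner ℝ (hasDerivAt_const (0 : ℝ) v)
  have hb' : ⟪W (x + (0 : ℝ) • l), y⟫ ≠ 0 := by simpa using hb
  have h4 := (((((hasDerivAt_const (0 : ℝ) (⟪y, y⟫ * ⟪u, v⟫)).fun_div
    ((h1.fun_pow 2).const_mul 2) (by simpa using hb)).fun_add
    ((hasDerivAt_const (0 : ℝ) (⟪y, u⟫ * ⟪y, v⟫)).fun_div (h1.fun_pow 2) (by simpa using hb))).fun_sub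
    ((((h3.const_mul ⟪y, u⟫).fun_add (h2.const_mul ⟪y, v⟫)).const_mul
    ⟪y, y⟫).fun_div (h1.fun_pow 3) (by simpa using hb)))).fun_add
    (((h2.const_mul (3 * ⟪y, y⟫ ^ 2)).fun_mul h3).fun_div ((h1.fun_pow 4).const_mul 4)
    (by simpa using hb))
  simp only [smul_zero, add_zero, navTensor]
  refine h4.congr_deriv ?_
  simp only [zero_smul, add_zero, inner_zero_right, zero_add, navTensorDeriv]
  field_simp
  ring

theorem dx_fundamentalTensor_navMetric (hW : ContDiff ℝ ∞ W) (hp : (x, y) ∈ halfSpace W)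
    (i j k : Fin n) :
    dx k (fun x y => fundamentalTensor (navMetric W) x y i j) x y =
      navTensorDeriv W x y (EuclideanSpace.single k 1) (EuclideanSpace.single i 1)
        (EuclideanSpace.single j 1) := by
  have hA := isOpen_halfSpace hW
  have hs := (smoothOn_navTensor hW (EuclideanSpace.single i 1) (EuclideanSpace.single j 1)).congr
    fun _ _ hp => fundamentalTensor_navMetric hW hp i j
  rw [dx_eq_dir (hs.differentiableAt hA hp),
    dir_congr hA hp fun _ _ hp => fundamentalTensor_navMetric hW hp i j, dir_navTensor hW hp]

theorem isLinearMap_navTensor (W : E n → E n) (x y u : E n) :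
    IsLinearMap ℝ fun v => navTensor W x y u v := by
  constructor <;> intros <;>
    simp only [navTensor, inner_add_right, real_inner_smul_right, smul_eq_mul] <;> ring

theorem navTensor_comm (W : E n → E n) (x y u v : E n) :
    navTensor W x y u v = navTensor W x y v u := by
  simp only [navTensor, real_inner_comm u v]; ring

theorem isLinearMap_navTensorDeriv_left (W : E n → E n) (x y u v : E n) :
    IsLinearMap ℝ fun l => navTensorDeriv W x y l u v := by
  constructor <;> intros <;>
    simp only [navTensorDeriv, inner_add_left, real_inner_smul_left, smul_eq_mul, map_add,
      map_smul] <;> ring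

theorem isLinearMap_navTensorDeriv_right (W : E n → E n) (x y l u : E n) :
    IsLinearMap ℝ fun v => navTensorDeriv W x y l u v := by
  constructor <;> intros <;>
    simp only [navTensorDeriv, inner_add_right, real_inner_smul_right, smul_eq_mul] <;> ring

theorem navTensorDeriv_comm (W : E n → E n) (x y l u v : E n) :
    navTensorDeriv W x y l u v = navTensorDeriv W x y l v u := by
  simp only [navTensorDeriv, real_inner_comm u v]; ring

theorem isLinearMap_navSpray (W : E n → E n) (x y : E n) :
    IsLinearMap ℝ fun z => navSpray W z x y := by
  constructor <;> intros <;>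
    simp only [navSpray, inner_add_right, real_inner_smul_right, smul_eq_mul, map_add, map_smul,
      inner_add_left, real_inner_smul_left] <;> ring

/-- Completing the square with respect to the splitting of `v` along `y` and the hyperplane
orthogonal to `W`. -/
theorem sq_mul_navTensor_self (hb : ⟪W x, y⟫ ≠ 0) (v : E n) :
    ⟪W x, y⟫ ^ 2 * navTensor W x y v v =
      ⟪y, y⟫ / 2 * ⟪v - (⟪W x, v⟫ / ⟪W x, y⟫) • y, v - (⟪W x, v⟫ / ⟪W x, y⟫) • y⟫
        + (⟪y, v⟫ - ⟪W x, v⟫ / ⟪W x, y⟫ * ⟪y, y⟫ / 2) ^ 2 := by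
  simp only [navTensor, inner_sub_left, inner_sub_right, real_inner_smul_left,
    real_inner_smul_right, real_inner_comm y v]
  field_simp
  ring

theorem navTensor_self_pos (hb : ⟪W x, y⟫ ≠ 0) {v : E n} (hv : v ≠ 0) :
    0 < navTensor W x y v v := by
  have hb2 : 0 < ⟪W x, y⟫ ^ 2 := by positivity
  have ha : 0 < ⟪y, y⟫ :=
    lt_of_le_of_ne real_inner_self_nonneg (inner_self_ne_zero_of_mem hb).symm
  refine pos_of_mul_pos_right (a := ⟪W x, y⟫ ^ 2) ?_ hb2.le
  rw [sq_mul_navTensor_self hb]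
  by_cases h : v - (⟪W x, v⟫ / ⟪W x, y⟫) • y = 0
  · rw [h, inner_zero_left, mul_zero, zero_add]
    set σ := ⟪W x, v⟫ / ⟪W x, y⟫
    rw [sub_eq_zero] at h
    have hσ : σ ≠ 0 := fun h0 => hv (by rw [h, h0, zero_smul])
    have : ⟪y, v⟫ - σ * ⟪y, y⟫ / 2 = σ * ⟪y, y⟫ / 2 := by
      rw [h, real_inner_smul_right]; ring
    rw [this]
    positivity
  · have : 0 < ⟪v - (⟪W x, v⟫ / ⟪W x, y⟫) • y, v - (⟪W x, v⟫ / ⟪W x, y⟫) • y⟫ :=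
      real_inner_self_pos.2 h
    positivity

theorem sum_navTensor_mul (W : E n → E n) (x y u v : E n) :
    ∑ i, ∑ j, navTensor W x y (EuclideanSpace.single i 1) (EuclideanSpace.single j 1)
      * u i * v j = navTensor W x y u v := by
  have h1 : ∀ i, ∑ j, navTensor W x y (EuclideanSpace.single i 1) (EuclideanSpace.single j 1)
      * u i * v j = navTensor W x y v (EuclideanSpace.single i 1) * u i := fun i => by
    rw [navTensor_comm, ← sum_map_single_mul (isLinearMap_navTensor W x y _) v, Finset.sum_mul]
    exact Finset.sum_congr rfl fun j _ => by ring
  simp only [h1]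
  rw [sum_map_single_mul (isLinearMap_navTensor W x y v) u, navTensor_comm]

theorem posDef_navMetric (hW : ContDiff ℝ ∞ W) (hp : (x, y) ∈ halfSpace W) :
    (fundamentalTensor (navMetric W) x y).PosDef := by
  have hb : ⟪W x, y⟫ ≠ 0 := ne_of_gt hp
  refine Matrix.PosDef.of_dotProduct_mulVec_pos ?_ fun v hv => ?_
  · ext i j
    simp [fundamentalTensor_navMetric hW hp, navTensor_comm W x y (EuclideanSpace.single i 1)]
  · have h := navTensor_self_pos hb (v := WithLp.toLp 2 v) (by simpa using hv)
    rw [← sum_navTensor_mul] at h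
    refine h.trans_eq ?_
    simp only [dotProduct, Matrix.mulVec, fundamentalTensor_navMetric hW hp, Finset.mul_sum]
    refine Finset.sum_congr rfl fun i _ => Finset.sum_congr rfl fun j _ => ?_
    simp
    ring

theorem isConicFinslerMetric_navMetric (hW : ContDiff ℝ ∞ W) (hunit : ∀ x, ‖W x‖ = 1) :
    IsConicFinslerMetric (halfSpace W) (navMetric W) where
  isOpen := isOpen_halfSpace hW
  nonempty x := ⟨W x, by simp [halfSpace, hunit]⟩
  conic x y h c hc := by
    simp only [halfSpace, Set.mem_ofPred_eq, real_inner_smul_right] at h ⊢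
    positivity
  smooth := smoothOn_navMetric hW
  pos x y h := by
    have hb : 0 < ⟪W x, y⟫ := h
    have ha : 0 < ⟪y, y⟫ :=
      lt_of_le_of_ne real_inner_self_nonneg (inner_self_ne_zero_of_mem hb.ne').symm
    unfold navMetric
    positivity
  homogeneous x y h c hc := by
    have hb : 0 < ⟪W x, y⟫ := h
    simp only [navMetric, real_inner_smul_right, real_inner_smul_left]
    field_simp
  posDef x y h := posDef_navMetric hW h

/-! ### The spray and the nonlinear connection of the Kropina metric -/

theorem inner_self_eq_one (hunit : ∀ x, ‖W x‖ = 1) (x : E n) : ⟪W x, W x⟫ = 1 := by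
  simp [hunit]

theorem inner_fderiv_self (hW : ContDiff ℝ ∞ W) (hunit : ∀ x, ‖W x‖ = 1) (x v : E n) :
    ⟪fderiv ℝ W x v, W x⟫ = 0 := by
  have hw := hasDerivAt_comp_line (x := x) (hW.differentiable (by simp) x) v
  have h1 := hw.inner ℝ hw
  simp only [inner_self_eq_one hunit] at h1
  have h2 := h1.unique (hasDerivAt_const (0 : ℝ) (1 : ℝ))
  simp only [zero_smul, add_zero, real_inner_comm (fderiv ℝ W x v)] at h2
  linarith

/-- The spray vector in closed form: the vector representing the linear form `z ↦ navSpray W z`. -/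
noncomputable def navSprayVector (W : E n → E n) (x y : E n) : E n :=
  WithLp.toLp 2 fun i => navSpray W (EuclideanSpace.single i 1) x y

theorem inner_toLp_of_isLinearMap {f : E n → ℝ} (hf : IsLinearMap ℝ f) (z : E n) :
    ⟪(WithLp.toLp 2 fun i => f (EuclideanSpace.single i 1) : E n), z⟫ = f z := by
  rw [← sum_map_single_mul hf z]
  simp [PiLp.inner_apply, mul_comm]

theorem inner_navSprayVector (W : E n → E n) (x y z : E n) :
    ⟪navSprayVector W x y, z⟫ = navSpray W z x y :=
  inner_toLp_of_isLinearMap (isLinearMap_navSpray W x y) z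

/-- The defining equation of the spray: `2 g(G, z)` is the Euler-Lagrange expression
`½ (y ∂_x) (∂_y F²) (z) - ½ ∂_x F² (z)`, with `F² = g(y, y)`. -/
theorem navTensor_navSprayVector (hW : ContDiff ℝ ∞ W) (hunit : ∀ x, ‖W x‖ = 1)
    (hb : ⟪W x, y⟫ ≠ 0) (z : E n) :
    navTensor W x y z (navSprayVector W x y) =
      (1 / 4) * (2 * navTensorDeriv W x y y z y - navTensorDeriv W x y z y y) := by
  have ha := inner_self_ne_zero_of_mem hb
  have h1 := inner_fderiv_self hW hunit x
  have h2 := inner_self_eq_one hunit x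
  simp only [navTensor, real_inner_comm (navSprayVector W x y), inner_navSprayVector, navSpray,
    navTensorDeriv, h1, h2, real_inner_comm (W x) y,
    real_inner_comm y z]
  field_simp
  ring

theorem spray_navMetric (hW : ContDiff ℝ ∞ W) (hunit : ∀ x, ‖W x‖ = 1)
    (hp : (x, y) ∈ halfSpace W) (i : Fin n) :
    spray (navMetric W) i x y = navSpray W (EuclideanSpace.single i 1) x y := by
  have hb : ⟪W x, y⟫ ≠ 0 := ne_of_gt hp
  set g := fundamentalTensor (navMetric W) x y with hg
  have hg1 : ∀ i j, g i j =
      navTensor W x y (EuclideanSpace.single i 1) (EuclideanSpace.single j 1) :=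
    fundamentalTensor_navMetric hW hp
  have hdet : IsUnit g.det := (Matrix.isUnit_iff_isUnit_det _).1 (posDef_navMetric hW hp).isUnit
  have h1 : ∀ s, ∑ j, ∑ k,
      (dx k (fun x y => fundamentalTensor (navMetric W) x y s j) x y
        - dx s (fun x y => fundamentalTensor (navMetric W) x y j k) x y
        + dx j (fun x y => fundamentalTensor (navMetric W) x y k s) x y) * y j * y k =
      4 * navTensor W x y (EuclideanSpace.single s 1) (navSprayVector W x y) := by
    intro s
    have e1 : ∑ j, ∑ k, navTensorDeriv W x y (EuclideanSpace.single k 1)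
        (EuclideanSpace.single s 1) (EuclideanSpace.single j 1) * y j * y k =
        navTensorDeriv W x y y (EuclideanSpace.single s 1) y := by
      rw [Finset.sum_comm, ← sum_map_single_mul (isLinearMap_navTensorDeriv_left W x y _ _) y]
      refine Finset.sum_congr rfl fun k _ => ?_
      rw [← sum_map_single_mul (isLinearMap_navTensorDeriv_right W x y _ _) y, Finset.sum_mul]
    have e2 : ∑ j, ∑ k, navTensorDeriv W x y (EuclideanSpace.single s 1)
        (EuclideanSpace.single j 1) (EuclideanSpace.single k 1) * y j * y k =
        navTensorDeriv W x y (EuclideanSpace.single s 1) y y := by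
      rw [← sum_map_single_mul (isLinearMap_navTensorDeriv_right W x y _ y) y]
      refine Finset.sum_congr rfl fun j _ => ?_
      rw [navTensorDeriv_comm, ← sum_map_single_mul (isLinearMap_navTensorDeriv_right W x y _ _) y,
        Finset.sum_mul]
      exact Finset.sum_congr rfl fun k _ => by ring
    have e3 : ∑ j, ∑ k, navTensorDeriv W x y (EuclideanSpace.single j 1)
        (EuclideanSpace.single k 1) (EuclideanSpace.single s 1) * y j * y k =
        navTensorDeriv W x y y (EuclideanSpace.single s 1) y := by
      rw [← e1, Finset.sum_comm]
      refine Finset.sum_congr rfl fun k _ => Finset.sum_congr rfl fun j _ => ?_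
      rw [navTensorDeriv_comm]; ring
    simp only [dx_fundamentalTensor_navMetric hW hp, add_mul, sub_mul, Finset.sum_add_distrib,
      Finset.sum_sub_distrib, e1, e2, e3, navTensor_navSprayVector hW hunit hb]
    ring
  have h2 : ∀ s, navTensor W x y (EuclideanSpace.single s 1) (navSprayVector W x y) =
      (g.mulVec fun m => navSpray W (EuclideanSpace.single m 1) x y) s := fun s => by
    rw [← sum_map_single_mul (isLinearMap_navTensor W x y _)]
    simp [Matrix.mulVec, dotProduct, hg1, navSprayVector]
  have h3 : spray (navMetric W) i x y =
      (g⁻¹.mulVec (g.mulVec fun m => navSpray W (EuclideanSpace.single m 1) x y)) i := by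
    rw [Matrix.mulVec, dotProduct]
    simp only [spray, christoffel, ← hg, ← h2]
    have : ∀ s, g⁻¹ i s * navTensor W x y (EuclideanSpace.single s 1) (navSprayVector W x y) =
      1 / 4 * ∑ j, ∑ k, g⁻¹ i s * (dx k (fun x y => fundamentalTensor (navMetric W) x y s j) x y
        - dx s (fun x y => fundamentalTensor (navMetric W) x y j k) x y
        + dx j (fun x y => fundamentalTensor (navMetric W) x y k s) x y) * y j * y k := fun s => by
      simp only [mul_assoc (g⁻¹ i s), ← Finset.mul_sum, h1 s]
      ring
    simp only [this]
    conv_rhs => rw [← Finset.mul_sum, Finset.sum_comm]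
    simp only [Finset.mul_sum, Finset.sum_mul]
    refine Finset.sum_congr rfl fun j _ => ?_
    conv_rhs => rw [Finset.sum_comm]
    refine Finset.sum_congr rfl fun k _ => Finset.sum_congr rfl fun s _ => ?_
    ring
  rw [h3, Matrix.mulVec_mulVec, Matrix.nonsing_inv_mul _ hdet, Matrix.one_mulVec]

/-- The derivative of `navSpray W z` with respect to `y` in the direction `v`, that is, the inner
product with `z` of the nonlinear connection of `navMetric W` applied to `v`. -/
noncomputable def navConnection (W : E n → E n) (z v x y : E n) : ℝ :=
  -((2 * ⟪y, v⟫ / (4 * ⟪W x, y⟫) - ⟪y, y⟫ * ⟪W x, v⟫ / (4 * ⟪W x, y⟫ ^ 2))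
      * (⟪fderiv ℝ W x y, z⟫ - ⟪fderiv ℝ W x z, y⟫ + ⟪fderiv ℝ W x (W x), y⟫ * ⟪W x, z⟫))
    - ⟪y, y⟫ / (4 * ⟪W x, y⟫)
      * (⟪fderiv ℝ W x v, z⟫ - ⟪fderiv ℝ W x z, v⟫ + ⟪fderiv ℝ W x (W x), v⟫ * ⟪W x, z⟫)
    + (⟪fderiv ℝ W x v, y⟫ + ⟪fderiv ℝ W x y, v⟫) * ⟪W x, z⟫ / 2
    + ⟪fderiv ℝ W x (W x), v⟫ * ⟪y, z⟫ / 2 + ⟪fderiv ℝ W x (W x), y⟫ * ⟪v, z⟫ / 2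
    - (⟪W x, v⟫ * ⟪fderiv ℝ W x y, y⟫ / ⟪y, y⟫
        + ⟪W x, y⟫ * (⟪fderiv ℝ W x v, y⟫ + ⟪fderiv ℝ W x y, v⟫) / ⟪y, y⟫
        - ⟪W x, y⟫ * ⟪fderiv ℝ W x y, y⟫ * (2 * ⟪y, v⟫) / ⟪y, y⟫ ^ 2) * ⟪y, z⟫
    - ⟪W x, y⟫ * ⟪fderiv ℝ W x y, y⟫ / ⟪y, y⟫ * ⟪v, z⟫

theorem dir_navSpray (hW : ContDiff ℝ ∞ W) (hp : (x, y) ∈ halfSpace W) (z v : E n) :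
    dir (navSpray W z) x y 0 v = navConnection W z v x y := by
  have hb : ⟪W x, y⟫ ≠ 0 := ne_of_gt hp
  have ha := inner_self_ne_zero_of_mem hb
  refine dir_eq_of_hasDerivAt ((smoothOn_navSpray hW z).differentiableAt (isOpen_halfSpace hW) hp)
    ?_
  have hc : ∀ u : E n, HasDerivAt (fun _ : ℝ => u) 0 0 := fun u => hasDerivAt_const 0 u
  have hy := hasDerivAt_line y v
  have hAy := (hasDerivAt_const (0 : ℝ) (fderiv ℝ W x)).clm_apply hy
  have h1 := hy.inner ℝ hy
  have h2 := (hc (W x)).inner ℝ hy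
  have h3 := hAy.inner ℝ (hc z)
  have h4 := (hc (fderiv ℝ W x z)).inner ℝ hy
  have h5 := (hc (fderiv ℝ W x (W x))).inner ℝ hy
  have h6 := hAy.inner ℝ hy
  have h7 := hy.inner ℝ (hc z)
  have h := (((((h1.fun_div (h2.const_mul 4) (by simpa using hb)).fun_neg.fun_mul
    ((h3.fun_sub h4).fun_add (h5.mul_const ⟪W x, z⟫))).fun_add
    ((h6.mul_const ⟪W x, z⟫).div_const 2)).fun_add ((h5.fun_mul h7).div_const 2)).fun_sub
    (((h2.fun_mul h6).fun_div h1 (by simpa using ha)).fun_mul h7))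
  simp only [smul_zero, add_zero, navSpray]
  refine h.congr_deriv ?_
  simp only [zero_smul, add_zero, zero_add, inner_zero_left, inner_zero_right,
    real_inner_comm y v, navConnection, zero_apply]
  field_simp
  ring

theorem smoothOn_navConnection (hW : ContDiff ℝ ∞ W) (z v : E n) :
    SmoothOn (halfSpace W) (navConnection W z v) :=
  ((smoothOn_navSpray hW z).dir (isOpen_halfSpace hW) 0 v).congr fun _ _ hp =>
    (dir_navSpray hW hp z v).symm

theorem isLinearMap_navConnection (W : E n → E n) (v x y : E n) :
    IsLinearMap ℝ fun z => navConnection W z v x y := by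
  constructor <;> intros <;>
    simp only [navConnection, inner_add_right, real_inner_smul_right, smul_eq_mul, map_add,
      map_smul, inner_add_left, real_inner_smul_left] <;> ring

/-- Euler's identity for the spray, which is homogeneous of degree two in `y`. -/
theorem navConnection_self (hb : ⟪W x, y⟫ ≠ 0) (z : E n) :
    navConnection W z y x y = 2 * navSpray W z x y := by
  have ha := inner_self_ne_zero_of_mem hb
  simp only [navConnection, navSpray]
  field_simp
  ring

theorem fderiv_fderiv_comm (hW : ContDiff ℝ ∞ W) (x u v : E n) :
    fderiv ℝ (fderiv ℝ W) x u v = fderiv ℝ (fderiv ℝ W) x v u :=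
  (hW.contDiffAt.isSymmSndFDerivAt (by
    rw [minSmoothness_of_isRCLikeNormedField]; exact WithTop.coe_le_coe.2 (le_top : (2 : ℕ∞) ≤ ⊤))) u v

theorem hasDerivAt_fderiv_line (hW : ContDiff ℝ ∞ W) (x u : E n) :
    HasDerivAt (fun s : ℝ => fderiv ℝ W (x + s • u)) (fderiv ℝ (fderiv ℝ W) x u) 0 :=
  hasDerivAt_comp_line ((smooth_fderiv hW).differentiable (by simp) x) u

/-- The derivative of `⟨DW(v), W⟩ = 0`. -/
theorem inner_fderiv_fderiv_self (hW : ContDiff ℝ ∞ W) (hunit : ∀ x, ‖W x‖ = 1) (x u v : E n) :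
    ⟪fderiv ℝ (fderiv ℝ W) x u v, W x⟫ = -⟪fderiv ℝ W x u, fderiv ℝ W x v⟫ := by
  have hw := hasDerivAt_comp_line (x := x) (hW.differentiable (by simp) x) u
  have h1 := ((hasDerivAt_fderiv_line hW x u).clm_apply (hasDerivAt_const (0 : ℝ) v)).inner ℝ hw
  simp only [inner_fderiv_self hW hunit] at h1
  have h2 := h1.unique (hasDerivAt_const (0 : ℝ) (0 : ℝ))
  simp only [zero_smul, add_zero, map_zero] at h2
  rw [real_inner_comm (fderiv ℝ W x v)]
  linarith

/-- The derivative of `⟨y, G⟩` along `W` in the base, with the left factor `y` frozen. -/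
theorem dir_navSpray_left (hW : ContDiff ℝ ∞ W) (hb : ⟪W x, y⟫ = 1) :
    2 * dir (navSpray W y) x y (W x) 0 =
      ⟪y, y⟫ / 2 * (⟪fderiv ℝ (fderiv ℝ W) x (W x) (W x), y⟫
        + ⟪fderiv ℝ W x (fderiv ℝ W x (W x)), y⟫)
      - ⟪fderiv ℝ (fderiv ℝ W) x (W x) y, y⟫
      - ⟪fderiv ℝ W x y, y⟫ * ⟪fderiv ℝ W x (W x), y⟫ := by
  have hp : (x, y) ∈ halfSpace W := by simp [halfSpace, hb]
  have hb' : ⟪W x, y⟫ ≠ 0 := ne_of_gt hp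
  have ha := inner_self_ne_zero_of_mem hb'
  suffices dir (navSpray W y) x y (W x) 0 = (⟪y, y⟫ / 2 *
      (⟪fderiv ℝ (fderiv ℝ W) x (W x) (W x), y⟫ + ⟪fderiv ℝ W x (fderiv ℝ W x (W x)), y⟫)
      - ⟪fderiv ℝ (fderiv ℝ W) x (W x) y, y⟫
      - ⟪fderiv ℝ W x y, y⟫ * ⟪fderiv ℝ W x (W x), y⟫) / 2 by rw [this]; ring
  refine dir_eq_of_hasDerivAt ((smoothOn_navSpray hW y).differentiableAt (isOpen_halfSpace hW) hp)
    ?_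
  have hc : ∀ u : E n, HasDerivAt (fun _ : ℝ => u) 0 0 := fun u => hasDerivAt_const 0 u
  have hw := hasDerivAt_comp_line (x := x) (hW.differentiable (by simp) x) (W x)
  have hA := hasDerivAt_fderiv_line hW x (W x)
  have h2 := hw.inner ℝ (hc y)
  have h3 := (hA.clm_apply (hc y)).inner ℝ (hc y)
  have h5 := (hA.clm_apply hw).inner ℝ (hc y)
  have h := ((((((hasDerivAt_const (0 : ℝ) ⟪y, y⟫).fun_div (h2.const_mul 4)
    (by simpa using hb')).fun_neg.fun_mul
    ((h3.fun_sub h3).fun_add (h5.fun_mul h2))).fun_add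
    ((h3.fun_mul h2).div_const 2)).fun_add ((h5.mul_const ⟪y, y⟫).div_const 2)).fun_sub
    (((h2.fun_mul h3).div_const ⟪y, y⟫).mul_const ⟪y, y⟫))
  simp only [smul_zero, add_zero, navSpray]
  refine h.congr_deriv ?_
  simp only [zero_smul, add_zero, zero_add, inner_zero_right, map_zero, inner_add_left, hb]
  field_simp
  ring

/-- The derivative in the direction `(y, p)` of `⟨y, N(W)⟩`, with `y` and the argument `W` frozen.
A primed scalar is the derivative of the unprimed one in this direction; `κw`, `τw` and `ρw` are the
derivatives of `⟨A W, W₀⟩`, of `⟨A W₀, y₀⟩ - ⟨A y₀, W₀⟩ + ⟨A W, W₀⟩ ⟨W, y₀⟩` and of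
`⟨A W₀, y⟩ + ⟨A y, W₀⟩`, where `A = DW` and the index marks the frozen vectors. -/
theorem dir_navConnection (hW : ContDiff ℝ ∞ W) (hunit : ∀ x, ‖W x‖ = 1)
    (hb : ⟪W x, y⟫ = 1) (p : E n) {a a' b' ρ ρ' ρw κ κ' κw τ' τw : ℝ} (ha : a = ⟪y, y⟫)
    (ha' : a' = 2 * ⟪y, p⟫) (hρ : ρ = ⟪fderiv ℝ W x y, y⟫) (hb' : b' = ρ + ⟪W x, p⟫)
    (hκ : κ = ⟪fderiv ℝ W x (W x), y⟫)
    (hκ' : κ' = ⟪fderiv ℝ (fderiv ℝ W) x (W x) y, y⟫ + ⟪fderiv ℝ W x (fderiv ℝ W x y), y⟫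
      + ⟪fderiv ℝ W x (W x), p⟫)
    (hκw : κw = -⟪fderiv ℝ W x (W x), fderiv ℝ W x y⟫)
    (hτ' : τ' = ⟪fderiv ℝ W x p, y⟫ - ⟪fderiv ℝ W x y, p⟫ + κ' + κ * ρ)
    (hτw : τw = ⟪fderiv ℝ (fderiv ℝ W) x (W x) y, y⟫ + ⟪fderiv ℝ W x y, fderiv ℝ W x y⟫ + κw)
    (hρw : ρw = ⟪fderiv ℝ (fderiv ℝ W) x (W x) y, y⟫ - ⟪fderiv ℝ W x y, fderiv ℝ W x y⟫
      + ⟪fderiv ℝ W x (W x), p⟫)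
    (hρ' : ρ' = ⟪fderiv ℝ W x p, y⟫ + ⟪fderiv ℝ W x y, p⟫
      + ⟪fderiv ℝ (fderiv ℝ W) x y y, y⟫) :
    dir (navConnection W y (W x)) x y y p =
      -(⟪W x, p⟫ * κ / 2 - b' * κ / 2 + τ' / 2) + (a' / 4 - a * b' / 2) * κ + a / 4 * τ'
        - (a' / 4 - a * b' / 4) * κ - a / 4 * τw + ρw / 2 + κ * ρ / 2 + κw * a / 2 + κ' / 2
        - (ρ' / a - ρ * a' / a ^ 2 + b' * κ / a + ρw / a - κ * a' / a ^ 2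
          - 2 * (b' * ρ + ρ' + ρ * ⟪W x, p⟫) / a ^ 2 + 4 * ρ * a' / a ^ 3) * a
        - (ρ / a + κ / a - 2 * ρ / a ^ 2) * (a' / 2)
        - (b' * ρ / a + ρ' / a - ρ * a' / a ^ 2) := by
  have hp : (x, y) ∈ halfSpace W := by simp [halfSpace, hb]
  have hb0 : ⟪W x, y⟫ ≠ 0 := ne_of_gt hp
  have ha0 := inner_self_ne_zero_of_mem hb0
  refine dir_eq_of_hasDerivAt
    ((smoothOn_navConnection hW y (W x)).differentiableAt (isOpen_halfSpace hW) hp) ?_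
  have hc : ∀ u : E n, HasDerivAt (fun _ : ℝ => u) 0 0 := fun u => hasDerivAt_const 0 u
  have hw := hasDerivAt_comp_line (x := x) (hW.differentiable (by simp) x) y
  have hA := hasDerivAt_fderiv_line hW x y
  have hy := hasDerivAt_line y p
  have hAy := hA.clm_apply hy
  have hAz := hA.clm_apply (hc y)
  have hAw := hA.clm_apply (hc (W x))
  have hAW := hA.clm_apply hw
  have a1 := hy.inner ℝ hy
  have b1 := hw.inner ℝ hy
  have aw := hy.inner ℝ (hc (W x))
  have bw := hw.inner ℝ (hc (W x))
  have om := hw.inner ℝ (hc y)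
  have ka := hAW.inner ℝ hy
  have kw := hAW.inner ℝ (hc (W x))
  have ta := ((hAy.inner ℝ (hc y)).fun_sub (hAz.inner ℝ hy)).fun_add (ka.fun_mul om)
  have tw := ((hAw.inner ℝ (hc y)).fun_sub (hAz.inner ℝ (hc (W x)))).fun_add (kw.fun_mul om)
  have rh := hAy.inner ℝ hy
  have rhw := (hAw.inner ℝ hy).fun_add (hAy.inner ℝ (hc (W x)))
  have ze := hy.inner ℝ (hc y)
  have nb : ⟪W (x + (0 : ℝ) • y), y + (0 : ℝ) • p⟫ ≠ 0 := by simpa using hb0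
  have na : ⟪y + (0 : ℝ) • p, y + (0 : ℝ) • p⟫ ≠ 0 := by simpa using ha0
  have h := (((((((((((aw.const_mul 2).fun_div (b1.const_mul 4) (mul_ne_zero (by simp) nb)).fun_sub
    ((a1.fun_mul bw).fun_div ((b1.fun_pow 2).const_mul 4)
      (mul_ne_zero (by simp) (pow_ne_zero _ nb)))).fun_mul ta).fun_neg).fun_sub
    ((a1.fun_div (b1.const_mul 4) (mul_ne_zero (by simp) nb)).fun_mul tw)).fun_add
    ((rhw.fun_mul om).div_const 2)).fun_add ((kw.fun_mul ze).div_const 2)).fun_add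
    ((ka.mul_const ⟪W x, y⟫).div_const 2)).fun_sub
    (((((bw.fun_mul rh).fun_div a1 na).fun_add ((b1.fun_mul rhw).fun_div a1 na)).fun_sub
    (((b1.fun_mul rh).fun_mul (aw.const_mul 2)).fun_div (a1.fun_pow 2)
      (pow_ne_zero _ na))).fun_mul ze)).fun_sub
    (((b1.fun_mul rh).fun_div a1 na).mul_const ⟪W x, y⟫))
  simp only [navConnection]
  refine h.congr_deriv ?_
  have e1 := inner_fderiv_self hW hunit x
  have e2 := inner_self_eq_one hunit x
  have e3 := inner_fderiv_fderiv_self hW hunit x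
  have e4 := fderiv_fderiv_comm hW x y (W x)
  simp only [zero_smul, add_zero, zero_add, inner_zero_right, map_zero, inner_add_left, hb, e1, e2,
    e3, e4, real_inner_comm (W x) y, real_inner_comm (W x) p, real_inner_comm y p]
  rw [← ha, ← hρ, ← hκ]
  rw [← ha] at ha0
  subst hτ' hτw hρw hρ' hκ' hκw hb' ha'
  field_simp
  ring

/-! ### The flag curvature of the Kropina metric -/

/-- On the half space the components of the spray are those of `navSpray`, so derivatives of the
spray paired with `z` are derivatives of `navSpray W z`. -/
theorem sum_dir_spray_mul (hW : ContDiff ℝ ∞ W) (hunit : ∀ x, ‖W x‖ = 1)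
    (hp : (x, y) ∈ halfSpace W) (z u v : E n) :
    ∑ r, dir (spray (navMetric W) r) x y u v * z r = dir (navSpray W z) x y u v := by
  have hA := isOpen_halfSpace hW
  have h1 : ∀ r, dir (spray (navMetric W) r) x y u v =
      dir (navSpray W (EuclideanSpace.single r 1)) x y u v := fun r =>
    dir_congr hA hp fun x y hp => spray_navMetric hW hunit hp r
  simp only [h1]
  rw [← dir_sum_mul_const (fun r => z r) fun r => (smoothOn_navSpray hW _).differentiableAt hA hp]
  exact dir_congr hA hp fun x y _ => sum_map_single_mul (isLinearMap_navSpray W x y) z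

theorem sum_dir_dir_spray_mul (hW : ContDiff ℝ ∞ W) (hunit : ∀ x, ‖W x‖ = 1)
    (hp : (x, y) ∈ halfSpace W) (z X u v : E n) :
    ∑ r, dir (fun x y => dir (spray (navMetric W) r) x y 0 X) x y u v * z r =
      dir (navConnection W z X) x y u v := by
  have hA := isOpen_halfSpace hW
  have h1 : ∀ r, dir (fun x y => dir (spray (navMetric W) r) x y 0 X) x y u v =
      dir (navConnection W (EuclideanSpace.single r 1) X) x y u v := fun r =>
    dir_congr hA hp fun x y hp => by
      rw [← dir_navSpray hW hp]
      exact dir_congr hA hp fun x y hp => spray_navMetric hW hunit hp r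
  simp only [h1]
  rw [← dir_sum_mul_const (fun r => z r) fun r =>
    (smoothOn_navConnection hW _ _).differentiableAt hA hp]
  exact dir_congr hA hp fun x y _ => sum_map_single_mul (isLinearMap_navConnection W X x y) z

theorem smoothOn_spray (hW : ContDiff ℝ ∞ W) (hunit : ∀ x, ‖W x‖ = 1) (i : Fin n) :
    SmoothOn (halfSpace W) (spray (navMetric W) i) :=
  (smoothOn_navSpray hW _).congr fun _ _ hp => spray_navMetric hW hunit hp i

theorem sum_nonlinearConnection_mul (hW : ContDiff ℝ ∞ W) (hunit : ∀ x, ‖W x‖ = 1) (i : Fin n)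
    (x y : E n) (hp : (x, y) ∈ halfSpace W) :
    ∑ j, nonlinearConnection (navMetric W) i j x y * y j = 2 * spray (navMetric W) i x y := by
  have hA := isOpen_halfSpace hW
  have h1 : ∀ j, nonlinearConnection (navMetric W) i j x y =
      navConnection W (EuclideanSpace.single i 1) (EuclideanSpace.single j 1) x y := fun j => by
    rw [nonlinearConnection_eq_dir hA (smoothOn_spray hW hunit) hp, ← dir_navSpray hW hp]
    exact dir_congr hA hp fun x y hp => spray_navMetric hW hunit hp i
  simp only [h1, ← dir_navSpray hW hp]
  rw [sum_map_single_mul (isLinearMap_dir_right _ x y), dir_navSpray hW hp,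
    navConnection_self (ne_of_gt hp), spray_navMetric hW hunit hp]

/-- The Euclidean inner product of `y` with the value at `W` of the curvature operator of the
flagpole `y`. The argument `W` and the left factor `y` are frozen when differentiating. -/
noncomputable def navCurvature (W : E n → E n) (x y : E n) : ℝ :=
  2 * dir (navSpray W y) x y (W x) 0
    - dir (navConnection W y (W x)) x y y ((-2 : ℝ) • navSprayVector W x y)
    - navConnection W y (WithLp.toLp 2 fun m =>
        navConnection W (EuclideanSpace.single m 1) (W x) x y) x y

theorem sum_curvature_eq_navCurvature (hW : ContDiff ℝ ∞ W) (hunit : ∀ x, ‖W x‖ = 1)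
    (hp : (x, y) ∈ halfSpace W) :
    ∑ r, (∑ h, ∑ j, ∑ k, curvature (navMetric W) h r j k x y * y h * y j * W x k) * y r =
      navCurvature W x y := by
  have hA := isOpen_halfSpace hW
  have e1 : sprayVector (navMetric W) x y = navSprayVector W x y := by
    ext i; exact spray_navMetric hW hunit hp i
  have e2 : ∀ m, dir (spray (navMetric W) m) x y 0 (W x) =
      navConnection W (EuclideanSpace.single m 1) (W x) x y := fun m => by
    rw [← dir_navSpray hW hp]
    exact dir_congr hA hp fun x y hp => spray_navMetric hW hunit hp m
  simp only [sum_curvature_mul_mul hA (smoothOn_spray hW hunit)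
    (sum_nonlinearConnection_mul hW hunit) hp]
  simp only [sub_mul, mul_assoc, Finset.sum_sub_distrib,
    ← Finset.mul_sum, sum_dir_spray_mul hW hunit hp, sum_dir_dir_spray_mul hW hunit hp, e1, e2,
    dir_navSpray hW hp]
  rfl

/-- The curvature is skew in its last two indices. -/
theorem sum_curvature_mul_self (F : E n → E n → ℝ) (r : Fin n) (x y : E n) :
    ∑ h, ∑ j, ∑ k, curvature F h r j k x y * y h * y j * y k = 0 := by
  refine Finset.sum_eq_zero fun h _ => ?_
  have h1 : ∑ j, ∑ k, curvature F h r j k x y * y h * y j * y k =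
      -∑ j, ∑ k, curvature F h r j k x y * y h * y j * y k := by
    conv_lhs => rw [Finset.sum_comm]
    rw [← Finset.sum_neg_distrib]
    refine Finset.sum_congr rfl fun j _ => ?_
    rw [← Finset.sum_neg_distrib]
    refine Finset.sum_congr rfl fun k _ => ?_
    rw [curvature_antisymm]; ring
  linarith

/-- The edge whose `g`-dual covector is a multiple of `⟨y, ·⟩`. -/
noncomputable def dualEdge (W : E n → E n) (x y : E n) : E n := W x + (3 - 2 / ⟪y, y⟫) • y

/-- The normalization `⟨W, y⟩ = 1` determines the coefficient of `y` in `dualEdge`. -/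
theorem navTensor_dualEdge (hunit : ∀ x, ‖W x‖ = 1) (hb : ⟪W x, y⟫ = 1) (z : E n) :
    navTensor W x y (dualEdge W x y) z = ⟪y, y⟫ / 2 * ⟪y, z⟫ := by
  have ha : ⟪y, y⟫ ≠ 0 := inner_self_ne_zero_of_mem (W := W) (x := x) (by simp [hb])
  simp only [navTensor, dualEdge, inner_add_left, inner_add_right, real_inner_smul_left,
    real_inner_smul_right, hb, inner_self_eq_one hunit, real_inner_comm (W x) y]
  field_simp
  ring

theorem sum_curvatureLow_dualEdge (hW : ContDiff ℝ ∞ W) (hunit : ∀ x, ‖W x‖ = 1)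
    (hb : ⟪W x, y⟫ = 1) :
    ∑ h, ∑ i, ∑ j, ∑ k, curvatureLow (navMetric W) h i j k x y * y h * dualEdge W x y i * y j
      * dualEdge W x y k = ⟪y, y⟫ / 2 * navCurvature W x y := by
  have hp : (x, y) ∈ halfSpace W := by simp [halfSpace, hb]
  set X := dualEdge W x y with hX
  have h1 : ∀ r, ∑ h, ∑ j, ∑ k, curvature (navMetric W) h r j k x y * y h * y j * X k =
      ∑ h, ∑ j, ∑ k, curvature (navMetric W) h r j k x y * y h * y j * W x k := fun r => by
    have h0 := sum_curvature_mul_self (navMetric W) r x y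
    have h2 : ∀ k, X k = W x k + y k * (3 - 2 / ⟪y, y⟫) := fun k => by
      simp [hX, dualEdge, mul_comm]
    simp only [h2, mul_add, Finset.sum_add_distrib, ← mul_assoc]
    simp only [← Finset.sum_mul, h0, zero_mul, add_zero]
  have h3 : ∀ r, ∑ i, fundamentalTensor (navMetric W) x y i r * X i = ⟪y, y⟫ / 2 * y r := by
    intro r
    simp only [fundamentalTensor_navMetric hW hp,
      navTensor_comm W x y _ (EuclideanSpace.single r 1)]
    rw [sum_map_single_mul (isLinearMap_navTensor W x y _), navTensor_comm,
      navTensor_dualEdge hunit hb, EuclideanSpace.inner_single_right]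
    simp
  rw [← sum_curvature_eq_navCurvature hW hunit hp, Finset.mul_sum]
  calc _ = ∑ r, (∑ h, ∑ j, ∑ k, curvature (navMetric W) h r j k x y * y h * y j * X k)
        * ∑ i, fundamentalTensor (navMetric W) x y i r * X i := by
        simp only [curvatureLow, Finset.sum_mul]
        simp only [Finset.mul_sum]
        symm
        rw [Finset.sum_comm' (t' := Finset.univ) (s' := fun _ => Finset.univ) (by simp)]
        refine Finset.sum_congr rfl fun h _ => ?_
        have : ∀ (f : Fin n → Fin n → Fin n → Fin n → ℝ), ∑ r, ∑ j, ∑ k, ∑ i, f r j k i =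
            ∑ i, ∑ j, ∑ k, ∑ r, f r j k i := fun f => by
          calc _ = ∑ r, ∑ i, ∑ j, ∑ k, f r j k i := by
                refine Finset.sum_congr rfl fun r _ => ?_
                conv_rhs => rw [Finset.sum_comm]
                refine Finset.sum_congr rfl fun j _ => ?_
                rw [Finset.sum_comm]
            _ = ∑ i, ∑ r, ∑ j, ∑ k, f r j k i := Finset.sum_comm
            _ = _ := by
                refine Finset.sum_congr rfl fun i _ => ?_
                rw [Finset.sum_comm]
                refine Finset.sum_congr rfl fun j _ => ?_
                rw [Finset.sum_comm]
        rw [this]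
        refine Finset.sum_congr rfl fun i _ => Finset.sum_congr rfl fun j _ =>
          Finset.sum_congr rfl fun k _ => Finset.sum_congr rfl fun r _ => ?_
        ring
    _ = _ := by
        refine Finset.sum_congr rfl fun r _ => ?_
        rw [h1, h3]
        ring

theorem sum_fundamentalTensor_mul (hW : ContDiff ℝ ∞ W) (hp : (x, y) ∈ halfSpace W) (X : E n) :
    ∑ h, ∑ i, ∑ j, ∑ k,
      (fundamentalTensor (navMetric W) x y h j * fundamentalTensor (navMetric W) x y i k
        - fundamentalTensor (navMetric W) x y h k * fundamentalTensor (navMetric W) x y i j)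
          * y h * X i * y j * X k =
      navTensor W x y y y * navTensor W x y X X - navTensor W x y y X * navTensor W x y X y := by
  rw [← sum_navTensor_mul W x y y y, ← sum_navTensor_mul W x y X X, ← sum_navTensor_mul W x y y X,
    ← sum_navTensor_mul W x y X y]
  simp only [fundamentalTensor_navMetric hW hp, sub_mul,
    Finset.sum_sub_distrib, Finset.sum_mul_sum]
  congr 1
  · refine Finset.sum_congr rfl fun h _ => Finset.sum_congr rfl fun i _ =>
      Finset.sum_congr rfl fun j _ => Finset.sum_congr rfl fun k _ => ?_
    ring
  · refine Finset.sum_congr rfl fun h _ => Finset.sum_congr rfl fun i _ => ?_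
    rw [Finset.sum_comm]
    refine Finset.sum_congr rfl fun j _ => Finset.sum_congr rfl fun k _ => ?_
    ring

/-- If the flag curvature along `dualEdge` vanishes, then so does `navCurvature`. The denominator of
the flag curvature is `|y|⁶ (|y|² - 1) / 8` there, hence nonzero. -/
theorem navCurvature_eq_zero (hW : ContDiff ℝ ∞ W) (hunit : ∀ x, ‖W x‖ = 1)
    (hb : ⟪W x, y⟫ = 1) (hy : ⟪y, y⟫ ≠ 1)
    (hK : flagCurvature (navMetric W) x y (dualEdge W x y) = 0) : navCurvature W x y = 0 := by
  have hp : (x, y) ∈ halfSpace W := by simp [halfSpace, hb]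
  have ha : ⟪y, y⟫ ≠ 0 := inner_self_ne_zero_of_mem (W := W) (x := x) (by simp [hb])
  rw [flagCurvature, sum_curvatureLow_dualEdge hW hunit hb, sum_fundamentalTensor_mul hW hp,
    navTensor_comm W x y y (dualEdge W x y), navTensor_dualEdge hunit hb,
    navTensor_dualEdge hunit hb] at hK
  have h1 : navTensor W x y y y * (⟪y, y⟫ / 2 * ⟪y, dualEdge W x y⟫)
      - ⟪y, y⟫ / 2 * ⟪y, y⟫ * (⟪y, y⟫ / 2 * ⟪y, y⟫) = ⟪y, y⟫ ^ 3 * (⟪y, y⟫ - 1) / 8 := by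
    simp only [navTensor, dualEdge, inner_add_right, real_inner_smul_right, hb,
      real_inner_comm (W x) y]
    field_simp
    ring
  rw [h1, div_eq_zero_iff] at hK
  rcases hK with h | h
  · exact (mul_eq_zero.1 h).resolve_left (div_ne_zero ha two_ne_zero)
  · exact absurd h (div_ne_zero (mul_ne_zero (pow_ne_zero 3 ha) (sub_ne_zero.2 hy)) (by norm_num))

/-- The expansion of `navCurvature` in powers of `|y|²` at points with `⟨W, y⟩ = 1`. What matters
is that the coefficients are polynomial in `y` and that the first is `-3 ⟨A y, y⟩²`. -/
theorem navCurvature_expansion (hW : ContDiff ℝ ∞ W) (hunit : ∀ x, ‖W x‖ = 1)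
    (hb : ⟪W x, y⟫ = 1) {A A' : E n →L[ℝ] E n} {B : E n →L[ℝ] E n →L[ℝ] E n}
    (hA : A = fderiv ℝ W x) (hA' : A' = ContinuousLinearMap.adjoint A)
    (hB : B = fderiv ℝ (fderiv ℝ W) x) {c : E n} (hc : c = A (W x))
    {a ρ κ : ℝ} (ha : a = ⟪y, y⟫) (hρ : ρ = ⟪A y, y⟫) (hκ : κ = ⟪c, y⟫) :
    a ^ 2 * navCurvature W x y = -3 * ρ ^ 2 + a * ((3 * κ * ρ + 3 * ρ ^ 2 - ⟪B y y, y⟫)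
      + a * (-⟪B (W x) y, y⟫ / 2 - 3 * κ * ρ - 3 / 4 * κ ^ 2 - 5 / 4 * ⟪A y, A y⟫ + ⟪B y y, y⟫
        + 3 / 4 * ⟪A' y, A' y⟫)
      + a ^ 2 * (⟪B (W x) (W x), y⟫ / 2 - 3 / 4 * ⟪A' y, A' y⟫ + 3 / 4 * κ ^ 2 + ⟪c, A y⟫ / 2
        + 3 / 4 * ⟪A y, A y⟫)
      + a ^ 3 * (-⟪A y, A' y⟫ / 8 + ⟪A' y, A' y⟫ / 16 - κ ^ 2 / 16 + ⟪A y, A y⟫ / 16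
        - ⟪c, A y⟫ / 8 + ⟪c, A' y⟫ / 8 + ⟪c, c⟫ / 16)) := by
  have hp : (x, y) ∈ halfSpace W := by simp [halfSpace, hb]
  have ha0 : a ≠ 0 := ha ▸ inner_self_ne_zero_of_mem (W := W) (x := x) (by simp [hb])
  have adj : ∀ u v, ⟪A u, v⟫ = ⟪u, A' v⟫ := fun u v => by
    rw [hA', ContinuousLinearMap.adjoint_inner_right]
  have e1 : ∀ v, ⟪A v, W x⟫ = 0 := fun v => hA ▸ inner_fderiv_self hW hunit x v
  have e2 := inner_self_eq_one hunit x
  set G := navSprayVector W x y with hG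
  set H : E n := WithLp.toLp 2 fun m => navConnection W (EuclideanSpace.single m 1) (W x) x y
    with hH
  have hGz : ∀ z, ⟪G, z⟫ = navSpray W z x y := inner_navSprayVector W x y
  have hHz : ∀ z, ⟪H, z⟫ = navConnection W z (W x) x y :=
    inner_toLp_of_isLinearMap (isLinearMap_navConnection W (W x) x y)
  rw [navCurvature, dir_navSpray_left hW hb, dir_navConnection hW hunit hb _ rfl rfl rfl rfl rfl
    rfl rfl rfl rfl rfl rfl, ← hG, ← hH]
  have e3 : ⟪A y, c⟫ = ⟪c, A y⟫ := real_inner_comm _ _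
  have e4 : ⟪y, A' y⟫ = ρ := by rw [← adj, hρ]
  have e5 : ⟪W x, A' y⟫ = κ := by rw [← adj, ← hc, hκ]
  have e6 : ⟪y, A y⟫ = ρ := by rw [real_inner_comm, hρ]
  have e7 : ⟪y, c⟫ = κ := by rw [real_inner_comm, hκ]
  have e8 : ⟪W x, A y⟫ = 0 := by rw [real_inner_comm, e1]
  have e9 : ⟪W x, c⟫ = 0 := by rw [real_inner_comm, hc, e1]
  have e10 : ⟪A' y, A y⟫ = ⟪A y, A' y⟫ := real_inner_comm _ _
  have e11 : ⟪c, W x⟫ = 0 := by rw [hc, e1]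
  have e12 : ⟪y, W x⟫ = 1 := by rw [real_inner_comm, hb]
  have b1 : ⟪A (A y), y⟫ = ⟪A y, A' y⟫ := adj _ _
  have b2 : ⟪A (A' y), y⟫ = ⟪A' y, A' y⟫ := adj _ _
  have b3 : ⟪A c, y⟫ = ⟪c, A' y⟫ := adj _ _
  have b4 : ⟪A G, y⟫ = ⟪G, A' y⟫ := adj _ _
  have b5 : ⟪A H, y⟫ = ⟪H, A' y⟫ := adj _ _
  have g1 : ⟪G, y⟫ = κ * a / 4 - ρ / 2 := by
    rw [hGz]
    simp only [navSpray, ← hA, ← hc, hb, ← ha, ← hρ, ← hκ]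
    field_simp
    ring
  have g2 : ⟪G, W x⟫ = ρ / 2 + κ / 2 - ρ / a := by
    rw [hGz]
    simp only [navSpray, ← hA, ← hc, hb, e1, e2, e12, ← ha, ← hρ, ← hκ]
    field_simp
    ring
  have g3 : ⟪G, c⟫ = -(a / 4 * (⟪c, A y⟫ - ⟪c, A' y⟫)) + κ ^ 2 / 2 - ρ * κ / a := by
    rw [hGz]
    simp only [navSpray, ← hA, ← hc, hb, e3, e7, e9, b3, ← ha, ← hρ, ← hκ]
    field_simp
    ring
  have g4 : ⟪G, A' y⟫ = -(a / 4 * (⟪A y, A' y⟫ - ⟪A' y, A' y⟫ + κ ^ 2)) + ρ * κ - ρ ^ 2 / a := by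
    rw [hGz]
    simp only [navSpray, ← hA, ← hc, hb, e4, e5, b2, ← ha, ← hρ, ← hκ]
    field_simp
    ring
  have g5 : ⟪G, A y⟫ = -(a / 4 * (⟪A y, A y⟫ - ⟪A y, A' y⟫)) + κ * ρ / 2 - ρ ^ 2 / a := by
    rw [hGz]
    simp only [navSpray, ← hA, ← hc, hb, e6, e8, b1, ← ha, ← hρ, ← hκ]
    field_simp
    ring
  have h1 : ⟪H, y⟫ = -κ / 2 - ρ + ρ / a := by
    rw [hHz]
    simp only [navConnection, ← hA, ← hc, hb, e1, e2, e11, e12, ← ha, ← hρ, ← hκ]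
    field_simp
    ring
  have h2 : ⟪H, W x⟫ = κ - (ρ / a + κ / a - 2 * ρ / a ^ 2) - ρ / a := by
    rw [hHz]
    simp only [navConnection, ← hA, ← hc, hb, e1, e2, e11, e12, ← ha, ← hρ, ← hκ]
    field_simp
    ring
  have h3 : ⟪H, c⟫ = (a / 4 - 1 / 2) * (⟪c, A y⟫ - ⟪c, A' y⟫) - a / 4 * ⟪c, c⟫
      - (ρ / a + κ / a - 2 * ρ / a ^ 2) * κ := by
    rw [hHz]
    simp only [navConnection, ← hA, ← hc, hb, e1, e2, e3, e7, e9, e11, e12, b3, ← ha, ← hρ, ← hκ]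
    field_simp
    ring
  have h4 : ⟪H, A y⟫ = (a / 4 - 1 / 2) * (⟪A y, A y⟫ - ⟪A y, A' y⟫) - a / 4 * ⟪c, A y⟫
      - (ρ / a + κ / a - 2 * ρ / a ^ 2) * ρ := by
    rw [hHz]
    simp only [navConnection, ← hA, ← hc, hb, e1, e2, e6, e8, e11, e12, b1, ← ha, ← hρ, ← hκ]
    field_simp
    ring
  have h5 : ⟪H, A' y⟫ = (a / 4 - 1 / 2) * (⟪A y, A' y⟫ - ⟪A' y, A' y⟫ + κ ^ 2)
      - a / 4 * ⟪c, A' y⟫ + κ ^ 2 - (ρ / a + κ / a - 2 * ρ / a ^ 2) * ρ - ρ / a * κ := by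
    rw [hHz]
    simp only [navConnection, ← hA, ← hc, hb, e1, e2, e4, e5, e11, e12, b2, ← ha, ← hρ, ← hκ]
    field_simp
    ring
  simp only [navConnection, ← hA, ← hB, ← hc, map_smul, real_inner_smul_left,
    real_inner_smul_right, hb, real_inner_comm G, real_inner_comm H, g1, g2, g3, g4,
    g5, h1, h2, h3, h4, h5, b1, b3, b4, b5, ← ha, ← hρ, ← hκ]
  field_simp
  ring

/-! ### Vanishing flag curvature -/

theorem linearIndependent_dualEdge {x y : E n} (hunit : ∀ x, ‖W x‖ = 1) (hb : ⟪W x, y⟫ = 1)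
    (hy : ⟪y, y⟫ ≠ 1) : LinearIndependent ℝ ![y, dualEdge W x y] := by
  rw [LinearIndependent.pair_iff]
  intro s r h
  have h1 := congrArg (fun v => ⟪W x, v⟫) h
  have h2 := congrArg (fun v => ⟪y, v⟫) h
  simp only [dualEdge, inner_add_right, real_inner_smul_right, inner_zero_right, hb,
    inner_self_eq_one hunit, real_inner_comm (W x) y] at h1 h2
  have h3 : r * (⟪y, y⟫ - 1) = 0 := by linear_combination ⟪y, y⟫ * h1 - h2
  have hr : r = 0 := (mul_eq_zero.1 h3).resolve_right (sub_ne_zero.2 hy)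
  subst hr
  exact ⟨by linarith, rfl⟩

/-- The symmetric part of `DW` has no component along `W, e` and `e, e`: along `y = W + t e` the
expansion of `navCurvature` says that `1 + t²` divides `3 ⟨DW(y), y⟩²` as a polynomial in `t`. -/
theorem inner_fderiv_eq_zero_of_orthogonal (hW : ContDiff ℝ ∞ W) (hunit : ∀ x, ‖W x‖ = 1)
    (hK : ∀ x y, ⟪W x, y⟫ = 1 → ⟪y, y⟫ ≠ 1 → navCurvature W x y = 0) (x : E n) {e : E n}
    (he : ‖e‖ = 1) (hWe : ⟪W x, e⟫ = 0) :
    ⟪fderiv ℝ W x (W x), e⟫ = 0 ∧ ⟪fderiv ℝ W x e, e⟫ = 0 := by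
  have hWW := inner_self_eq_one hunit x
  have hee : ⟪e, e⟫ = 1 := by simp [he]
  have heW : ⟪e, W x⟫ = 0 := by rw [real_inner_comm, hWe]
  have hA := inner_fderiv_self hW hunit x
  have hb : ∀ t : ℝ, ⟪W x, W x + t • e⟫ = 1 := fun t => by
    rw [inner_add_right, real_inner_smul_right, hWW, hWe]; ring
  have ha : ∀ t : ℝ, 1 + t ^ 2 = ⟪W x + t • e, W x + t • e⟫ := fun t => by
    simp only [inner_add_right, inner_add_left, real_inner_smul_right, real_inner_smul_left, hWW,
      hWe, heW, hee]
    ring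
  have hρ : ∀ t : ℝ, t * ⟪fderiv ℝ W x (W x), e⟫ + t ^ 2 * ⟪fderiv ℝ W x e, e⟫ =
      ⟪fderiv ℝ W x (W x + t • e), W x + t • e⟫ := fun t => by
    simp only [inner_add_right, inner_add_left, real_inner_smul_right, real_inner_smul_left,
      map_add, map_smul, hA]
    ring
  have key : ∀ t : ℝ, t ≠ 0 → _ := fun t ht => by
    -- `key` takes the shape of the expansion, with `|y|² = 1 + t²`
    have h0 := navCurvature_expansion hW hunit (hb t) rfl rfl rfl rfl (ha t) (hρ t) rfl
    rw [hK x _ (hb t) (by rw [← ha t]; simpa using ht), mul_zero] at h0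
    exact h0.symm
  refine IsPolynomialFun.eq_zero_of_one_add_sq_dvd ?_ key
  simp only [map_add, map_smul, inner_add_left, inner_add_right, real_inner_smul_left,
    real_inner_smul_right, add_apply, smul_apply]
  repeat' first
    | exact IsPolynomialFun.const _
    | exact IsPolynomialFun.id
    | apply IsPolynomialFun.add
    | apply IsPolynomialFun.sub
    | apply IsPolynomialFun.mul
    | apply IsPolynomialFun.neg

/-- If `navCurvature` vanishes, then `W` is a Killing vector field. -/
theorem inner_fderiv_self_eq_zero (hW : ContDiff ℝ ∞ W) (hunit : ∀ x, ‖W x‖ = 1)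
    (hK : ∀ x y, ⟪W x, y⟫ = 1 → ⟪y, y⟫ ≠ 1 → navCurvature W x y = 0) (x y : E n) :
    ⟪fderiv ℝ W x y, y⟫ = 0 := by
  have hA := inner_fderiv_self hW hunit x
  set v := y - ⟪W x, y⟫ • W x with hv
  have hy : y = ⟪W x, y⟫ • W x + v := by rw [hv]; abel
  have hWv : ⟪W x, v⟫ = 0 := by
    rw [hv, inner_sub_right, real_inner_smul_right, inner_self_eq_one hunit]; ring
  have hsplit : ⟪fderiv ℝ W x y, y⟫ =
      ⟪W x, y⟫ * ⟪fderiv ℝ W x (W x), v⟫ + ⟪fderiv ℝ W x v, v⟫ := by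
    generalize ⟪W x, y⟫ = b at hy
    rw [hy]
    simp only [inner_add_right, inner_add_left, real_inner_smul_right, real_inner_smul_left,
      map_add, map_smul, hA]
    ring
  rw [hsplit]
  by_cases h0 : v = 0
  · simp [h0]
  · have hn : ‖v‖ ≠ 0 := norm_ne_zero_iff.2 h0
    obtain ⟨h1, h2⟩ := inner_fderiv_eq_zero_of_orthogonal hW hunit hK x (e := ‖v‖⁻¹ • v)
      (by rw [norm_smul, norm_inv, norm_norm, inv_mul_cancel₀ hn])
      (by rw [real_inner_smul_right, hWv, mul_zero])
    simp only [map_smul, real_inner_smul_right, real_inner_smul_left, mul_eq_zero, inv_eq_zero, hn,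
      false_or] at h1 h2
    rw [h1, h2, mul_zero, add_zero]

/-- A unit Killing vector field on Euclidean space is constant. -/
theorem fderiv_eq_zero_of_killing (hW : ContDiff ℝ ∞ W) (hunit : ∀ x, ‖W x‖ = 1)
    (hK : ∀ x y, ⟪fderiv ℝ W x y, y⟫ = 0) (x : E n) : fderiv ℝ W x = 0 := by
  have hskew : ∀ x u v, ⟪fderiv ℝ W x u, v⟫ + ⟪fderiv ℝ W x v, u⟫ = 0 := fun x u v => by
    have := hK x (u + v)
    simp only [map_add, inner_add_left, inner_add_right, hK] at this
    linarith
  set B := fderiv ℝ (fderiv ℝ W) x with hB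
  have hsymm : ∀ u v, B u v = B v u := fderiv_fderiv_comm hW x
  have hBskew : ∀ d u v, ⟪B d u, v⟫ = -⟪B d v, u⟫ := fun d u v => by
    have hA := hasDerivAt_fderiv_line hW x d
    have hc : ∀ u : E n, HasDerivAt (fun _ : ℝ => u) 0 0 := fun u => hasDerivAt_const 0 u
    have h := ((hA.clm_apply (hc u)).inner ℝ (hc v)).fun_add
      ((hA.clm_apply (hc v)).inner ℝ (hc u))
    simp only [hskew] at h
    have h2 := h.unique (hasDerivAt_const (0 : ℝ) (0 : ℝ))
    simp only [inner_zero_right, map_zero, add_zero, zero_add, ← hB] at h2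
    linarith
  ext1 u
  -- `⟨B u v, w⟩` is symmetric in `u, v` and skew in `v, w`; this already kills `⟨B u u, w⟩`.
  have h0 : ⟪B u u, W x⟫ = 0 := by
    have h1 := hBskew u u (W x)
    have h2 := hBskew (W x) u u
    rw [hsymm u (W x)] at h1
    linarith
  rw [inner_fderiv_fderiv_self hW hunit, neg_eq_zero, inner_self_eq_zero] at h0
  simpa using h0

theorem hasConstantFlagCurvature_navMetric_iff (hW : ContDiff ℝ ∞ W) (hunit : ∀ x, ‖W x‖ = 1) :
    HasConstantFlagCurvature (halfSpace W) (navMetric W) 0 ↔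
      ∃ C : E n, ‖C‖ = 1 ∧ ∀ x, W x = C := by
  constructor
  · rintro ⟨-, hK⟩
    have h1 : ∀ x y, ⟪W x, y⟫ = 1 → ⟪y, y⟫ ≠ 1 → navCurvature W x y = 0 := fun x y hb hy =>
      navCurvature_eq_zero hW hunit hb hy (hK x y _ (by simp [halfSpace, hb])
        (linearIndependent_dualEdge hunit hb hy))
    have h2 := fderiv_eq_zero_of_killing hW hunit (inner_fderiv_self_eq_zero hW hunit h1)
    exact ⟨W 0, hunit 0, fun x => is_const_of_fderiv_eq_zero (hW.differentiable (by simp)) h2 x 0⟩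
  · rintro ⟨C, -, hC⟩
    refine ⟨isConicFinslerMetric_navMetric hW hunit, fun x y X _ _ => ?_⟩
    exact flagCurvature_of_forall_eq (f := fun y => ⟪y, y⟫ / (2 * ⟪C, y⟫))
      (fun x => by funext y; rw [navMetric, hC]) x y X

end Kropina

theorem proposition6p3 (n : ℕ) (hn : 2 ≤ n)
    (W : ConicFinsler.E n → ConicFinsler.E n) (hW : ContDiff ℝ ∞ W) (hunit : ∀ x, ‖W x‖ = 1)
    (k : ConicFinsler.E n → ℝ) (hk : ContDiff ℝ ∞ k) :
    ConicFinsler.HasConstantFlagCurvature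
        (Kropina.domain (Kropina.navB (Kropina.flat n) k W))
        (Kropina.metric (Kropina.navA (Kropina.flat n) k) (Kropina.navB (Kropina.flat n) k W)) 0 ↔
      ∃ C : ConicFinsler.E n, ‖C‖ = 1 ∧ ∀ x, W x = C := by
  rw [Kropina.metric_flat, Kropina.domain_flat]
  exact Kropina.hasConstantFlagCurvature_navMetric_iff hW hunit
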